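/- Let $-\infty\le a<b\le\infty$, let $V\in L^1_{loc}(a,b)$ be real valued, let $I\subseteq\mathbb Z$, and let $M=\{x_n\}_{n\in I}\subset(a,b)$ be a set of distinct points which accumulates at most at $a$ or $b$. Let $p_n$, $n\in I$, be Borel probability measures on $\mathbb R$ without atoms, and let $(\Omega,\mathcal F,\mathbb P)$ be the completion of the product space $(\mathbb R^I,\bigotimes_{n} \mathcal B(\mathbb R),\prod_{n\in I}p_n)$. For $\omega\in\Omega=\mathbb R^I$ consider $\tau_\omega=-\frac{d^2}{dx^2}+V+\sum_{n\in I}\omega(n)\delta(x-x_n)$. A function $u:(a,b)\to\mathbb C$ is called admissible for $\omega$ if $u$ is differentiable on $(a,b)\setminus M$, $u,u'$ are locally absolutely continuous in $(a,b)\setminus M$, and $u(x_n+)=u(x_n-)=u(x_n)$, $u'(x_n+)-u'(x_n-)=\omega(n)u(x_n)$ for all $n\in I$. A solution of $(\tau_\omega-z)u=0$ is an admissible $u$ with $-u''+Vu=zu$ almost everywhere. Say that $\tau_\omega$ is regular at $a$ if $a$ is finite, $V\in L^1_{loc}[a,b)$ and $a$ is not an accumulation point of $M$, and that it is in the limit point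 case at $a$ if for every $z\in\mathbb C$ some solution of $(\tau_\omega-z)u=0$ is not square integrable near $a$; similarly at $b$. Assume that, for every $\omega\in\Omega$, at each of the two endpoints $\tau_\omega$ is regular or in the limit point case. Fix $\theta,\gamma\in[0,\pi)$ and let $H_\omega$ be the operator $H_\omega u=-u''+Vu$ in the complex Hilbert space $L^2(a,b)$ whose domain consists of all admissible $u\in L^2(a,b)$ with $-u''+Vu\in L^2(a,b)$ such that $u(a)\cos\theta+u'(a)\sin\theta=0$ if $\tau_\omega$ is regular at $a$, and $u(b)\cos\gamma+u'(b)\sin\gamma=0$ if $\tau_\omega$ is regular at $b$. For $E\in\mathbb R$ let $A(E)$ be the set of all $\omega\in\Omega$ such that $E$ is an eigenvalue of $H_\omega$. 1. Assume that the family $\{H_\omega\}_{\omega\in\Omega}$ is measurable, that is, $\omega\mapsto\langle\varphi,E_\omega(\lambda)\psi\rangle$ is measurable on $(\Omega,\mathcal F)$ for all $\lambda\in\mathbb R$ and $\varphi,\psi\in L^2(a,b)$, where $E_\omega$ is the resolution of identity of $H_\omega$. Then, for each fixed $E\in\mathbb R$, either $\mathbb P(A(E))=0$ or $A(E)=\Omega$.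 2. Suppose that $(a,b)=\mathbb R$, $V=0$, all $p_n$ are equal (independent, identically distributed couplings), and $p_n(\mathbb R\setminus[-C,C])=0$ for all $n$ and some $C<\infty$ (bounded couplings). Then $\mathbb P(A(E))=0$ for every $E\in\mathbb R$. -/

import Mathlib

open MeasureTheory Filter Topology Set

noncomputable section

/-! ### Unbounded operators: eigenvalues, resolutions of identity, measurable families -/

section Operators

variable {H : Type*} [NormedAddCommGroup H] [InnerProductSpace ℂ H]

/-- The real number `E` belongs to the point spectrum of the (partially defined) operator `S`. -/
def IsRealEigenvalue (S : H →ₗ.[ℂ] H) (E : ℝ) : Prop :=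
  ∃ ψ : S.domain, (ψ : H) ≠ 0 ∧ S ψ = (E : ℂ) • (ψ : H)

/-- A spectral family (resolution of the identity) in the Hilbert space `H`: an increasing,
strongly right-continuous family of orthogonal projections `proj t`, `t ∈ ℝ`, which tends
strongly to `0` as `t → -∞` and to the identity as `t → ∞`. -/
structure SpectralFamily (H : Type*) [NormedAddCommGroup H] [InnerProductSpace ℂ H] where
  proj : ℝ → H →L[ℂ] H
  idempotent : ∀ t ψ, proj t (proj t ψ) = proj t ψ
  symmetric : ∀ t φ ψ, inner ℂ (proj t φ) ψ = inner ℂ φ (proj t ψ)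
  increasing : ∀ s t, s ≤ t → ∀ ψ, proj s (proj t ψ) = proj s ψ
  right_continuous : ∀ t ψ, Tendsto (fun s => proj s ψ) (𝓝[>] t) (𝓝 (proj t ψ))
  tendsto_atBot : ∀ ψ, Tendsto (fun s => proj s ψ) atBot (𝓝 0)
  tendsto_atTop : ∀ ψ, Tendsto (fun s => proj s ψ) atTop (𝓝 ψ)

namespace SpectralFamily

theorem norm_proj_le (F : SpectralFamily H) (t : ℝ) (ψ : H) : ‖F.proj t ψ‖ ≤ ‖ψ‖ := by
  have h1 : inner ℂ (F.proj t ψ) (F.proj t ψ) = inner ℂ ψ (F.proj t ψ) := by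
    rw [F.symmetric, F.idempotent]
  have h2 : ‖F.proj t ψ‖ ^ 2 ≤ ‖ψ‖ * ‖F.proj t ψ‖ := by
    have h3 := norm_inner_le_norm (𝕜 := ℂ) ψ (F.proj t ψ)
    rw [← h1, inner_self_eq_norm_sq_to_K] at h3
    simpa using h3
  by_contra! hlt
  nlinarith [norm_nonneg ψ, norm_nonneg (F.proj t ψ)]

/-- The function `t ↦ ⟨ψ, E(t) ψ⟩ = ‖E(t) ψ‖²` of a spectral family. -/
def stieltjes (F : SpectralFamily H) (ψ : H) : StieltjesFunction ℝ where
  toFun t := ‖F.proj t ψ‖ ^ 2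
  mono' s t hst := by
    have h := F.norm_proj_le s (F.proj t ψ)
    rw [F.increasing s t hst] at h
    exact pow_le_pow_left₀ (norm_nonneg _) h 2
  right_continuous' t := by
    have h : ContinuousWithinAt (fun s => F.proj s ψ) (Ioi t) t := F.right_continuous t ψ
    exact (continuousWithinAt_Ioi_iff_Ici.1 h).norm.pow 2

/-- The spectral measure `d⟨ψ, E(t) ψ⟩` of the vector `ψ`. -/
def measure (F : SpectralFamily H) (ψ : H) : Measure ℝ := (F.stieltjes ψ).measure

/-- `F` is the resolution of identity of `S`, that is `S = ∫ t dE(t)`: the domain of `S` consists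
of the `ψ` with `∫ t² d⟨ψ, E(t) ψ⟩ < ∞`, and `⟨ψ, S ψ⟩ = ∫ t d⟨ψ, E(t) ψ⟩` on that domain (which,
by polarization, determines `S`). By the spectral theorem every selfadjoint operator in a Hilbert
space has exactly one resolution of identity. -/
structure IsResolutionOf (F : SpectralFamily H) (S : H →ₗ.[ℂ] H) : Prop where
  mem_domain_iff : ∀ ψ : H, ψ ∈ S.domain ↔ Integrable (fun t : ℝ => t ^ 2) (F.measure ψ)
  inner_apply : ∀ ψ : S.domain,
    inner ℂ (ψ : H) (S ψ) = ((∫ t : ℝ, t ∂F.measure (ψ : H) : ℝ) : ℂ)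

end SpectralFamily

/-- A family `S ω` of selfadjoint operators is measurable if all the functions
`ω ↦ ⟨φ, E_ω(t) ψ⟩` are measurable, where `E_ω` is the resolution of identity of `S ω`. -/
def MeasurableFamily {Ω : Type*} [MeasurableSpace Ω] (S : Ω → H →ₗ.[ℂ] H) : Prop :=
  ∃ F : Ω → SpectralFamily H, (∀ ω, (F ω).IsResolutionOf (S ω)) ∧
    ∀ (t : ℝ) (φ ψ : H), Measurable fun ω => (inner ℂ φ ((F ω).proj t ψ) : ℂ)

end Operators

/-! ### Sturm-Liouville operators with `δ`-interactions -/

/-- The deterministic data: an interval `(a, b)` with `-∞ ≤ a < b ≤ ∞`, a real potential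
`V ∈ L¹_loc(a, b)`, a set of distinct interaction points `x n ∈ (a, b)`, `n ∈ I ⊆ ℤ`, which
accumulates at most at `a` or `b`, and boundary angles `θ, γ ∈ [0, π)`. -/
structure DeltaData where
  a : EReal
  b : EReal
  a_lt_b : a < b
  V : ℝ → ℝ
  V_loc : LocallyIntegrableOn V {t : ℝ | a < t ∧ t < b}
  I : Set ℤ
  x : I → ℝ
  x_mem : ∀ n, a < x n ∧ x n < b
  x_inj : Function.Injective x
  x_locFin : ∀ c d : ℝ, a < c → d < b → {n | x n ∈ Icc c d}.Finite
  θ : ℝ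
  θ_mem : θ ∈ Ico 0 Real.pi
  γ : ℝ
  γ_mem : γ ∈ Ico 0 Real.pi

namespace DeltaData

variable (D : DeltaData)

/-- The interval `(a, b)`. -/
def J : Set ℝ := {t : ℝ | D.a < t ∧ t < D.b}

/-- The set of interaction points. -/
def M : Set ℝ := range D.x

/-- `u` and `u'` are (locally) absolutely continuous in `(a, b) \ M`, and at each interaction point
`u(xₙ+) = u(xₙ-) = u(xₙ)` and `u'(xₙ+) - u'(xₙ-) = ω(n) u(xₙ)`. -/
structure IsAdmissible (ω : D.I → ℝ) (u : ℝ → ℂ) : Prop where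
  differentiable : ∀ t ∈ D.J \ D.M, DifferentiableAt ℝ u t
  ac : ∀ c d : ℝ, c ≤ d → Icc c d ⊆ D.J \ D.M → AbsolutelyContinuousOnInterval u c d
  ac_deriv : ∀ c d : ℝ, c ≤ d → Icc c d ⊆ D.J \ D.M → AbsolutelyContinuousOnInterval (deriv u) c d
  continuousAt : ∀ n, ContinuousAt u (D.x n)
  jump : ∀ n, ∃ l r : ℂ, Tendsto (deriv u) (𝓝[<] D.x n) (𝓝 l) ∧
    Tendsto (deriv u) (𝓝[>] D.x n) (𝓝 r) ∧ r - l = (ω n : ℂ) * u (D.x n)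

/-- The differential expression `τ u = -u'' + V u`. -/
def tau (u : ℝ → ℂ) (t : ℝ) : ℂ := -deriv (deriv u) t + (D.V t : ℂ) * u t

/-- `u` is a solution of `(τ_ω - z) u = 0`. -/
def IsSolution (ω : D.I → ℝ) (z : ℂ) (u : ℝ → ℂ) : Prop :=
  D.IsAdmissible ω u ∧ ∀ᵐ t ∂volume.restrict D.J, D.tau u t - z * u t = 0

/-- `u` is square integrable in a neighbourhood of `a`. -/
def LiesLeft (u : ℝ → ℂ) : Prop :=
  ∃ c ∈ D.J, MemLp u 2 (volume.restrict (D.J ∩ Iio c))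

/-- `u` is square integrable in a neighbourhood of `b`. -/
def LiesRight (u : ℝ → ℂ) : Prop :=
  ∃ c ∈ D.J, MemLp u 2 (volume.restrict (D.J ∩ Ioi c))

/-- `τ_ω` is in the limit point case at `a`. -/
def LimitPointLeft (ω : D.I → ℝ) : Prop :=
  ∀ z : ℂ, ∃ u, D.IsSolution ω z u ∧ ¬ D.LiesLeft u

/-- `τ_ω` is in the limit point case at `b`. -/
def LimitPointRight (ω : D.I → ℝ) : Prop :=
  ∀ z : ℂ, ∃ u, D.IsSolution ω z u ∧ ¬ D.LiesRight u

/-- `τ_ω` is regular at `a`: `a` is finite, `V ∈ L¹_loc[a, b)`, and `a` is not an accumulation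
point of `M`. (This does not depend on `ω`.) -/
def RegularLeft : Prop :=
  ∃ a₀ : ℝ, D.a = a₀ ∧ LocallyIntegrableOn D.V {t : ℝ | D.a ≤ t ∧ t < D.b} ∧
    ¬ AccPt a₀ (𝓟 D.M)

/-- `τ_ω` is regular at `b`. -/
def RegularRight : Prop :=
  ∃ b₀ : ℝ, D.b = b₀ ∧ LocallyIntegrableOn D.V {t : ℝ | D.a < t ∧ t ≤ D.b} ∧
    ¬ AccPt b₀ (𝓟 D.M)

/-- At each endpoint, for every `ω`, `τ_ω` is regular or in the limit point case. -/
def LimitPointOrRegular : Prop :=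
  ∀ ω : D.I → ℝ, (D.LimitPointLeft ω ∨ D.RegularLeft) ∧ (D.LimitPointRight ω ∨ D.RegularRight)

/-- The boundary condition `u(a) cos θ + u'(a) sin θ = 0`, imposed if `τ_ω` is regular at `a`
(`u(a)` and `u'(a)` are the limits at `a` of `u` and `u'`). -/
def BoundaryLeft (u : ℝ → ℂ) : Prop :=
  D.RegularLeft → ∃ y y' : ℂ, Tendsto u (𝓝[>] D.a.toReal) (𝓝 y) ∧
    Tendsto (deriv u) (𝓝[>] D.a.toReal) (𝓝 y') ∧ y * (Real.cos D.θ : ℂ) + y' * (Real.sin D.θ : ℂ) = 0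

/-- The boundary condition `u(b) cos γ + u'(b) sin γ = 0`, imposed if `τ_ω` is regular at `b`. -/
def BoundaryRight (u : ℝ → ℂ) : Prop :=
  D.RegularRight → ∃ y y' : ℂ, Tendsto u (𝓝[<] D.b.toReal) (𝓝 y) ∧
    Tendsto (deriv u) (𝓝[<] D.b.toReal) (𝓝 y') ∧ y * (Real.cos D.γ : ℂ) + y' * (Real.sin D.γ : ℂ) = 0

/-- The Hilbert space `L²(a, b)` of complex valued functions. -/
abbrev L2 : Type := Lp ℂ 2 (volume.restrict D.J)

variable {D}

theorem isOpen_J : IsOpen D.J := by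
  have h : D.J = (fun t : ℝ => (t : EReal)) ⁻¹' Ioo D.a D.b := rfl
  rw [h]
  exact isOpen_Ioo.preimage continuous_coe_real_ereal

theorem exists_Icc_mem_nhds {U : Set ℝ} {t : ℝ} (h : U ∈ 𝓝 t) :
    ∃ c d : ℝ, c < t ∧ t < d ∧ Icc c d ⊆ U := by
  obtain ⟨ε, hε, hb⟩ := Metric.nhds_basis_closedBall.mem_iff.1 h
  refine ⟨t - ε, t + ε, by linarith, by linarith, ?_⟩
  rwa [← Real.closedBall_eq_Icc]

/-- Punctured neighbourhoods in `(a, b)` are eventually free of interaction points. -/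
theorem eventually_notMem_M {t : ℝ} (ht : t ∈ D.J) : ∀ᶠ s in 𝓝[≠] t, s ∈ D.J \ D.M := by
  obtain ⟨c, d, hc, hd, hcd⟩ := exists_Icc_mem_nhds (isOpen_J.mem_nhds ht)
  have hfin : (D.x '' {n | D.x n ∈ Icc c d}).Finite :=
    (D.x_locFin c d (hcd ⟨le_rfl, (hc.trans hd).le⟩).1 (hcd ⟨(hc.trans hd).le, le_rfl⟩).2).image _
  have h1 : (D.x '' {n | D.x n ∈ Icc c d} \ {t})ᶜ ∈ 𝓝 t :=
    (hfin.subset sdiff_subset).isClosed.isOpen_compl.mem_nhds (by simp)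
  filter_upwards [self_mem_nhdsWithin, mem_nhdsWithin_of_mem_nhds h1,
    mem_nhdsWithin_of_mem_nhds (Icc_mem_nhds hc hd)] with s hs1 hs2 hs3
  refine ⟨hcd hs3, ?_⟩
  rintro ⟨n, rfl⟩
  exact hs2 ⟨⟨n, hs3, rfl⟩, hs1⟩

theorem isOpen_J_diff_M : IsOpen (D.J \ D.M) := by
  rw [isOpen_iff_mem_nhds]
  intro t ht
  have h := eventually_nhdsWithin_iff.1 (eventually_notMem_M ht.1)
  filter_upwards [h] with s hs
  by_cases hst : s = t
  · exact hst ▸ ht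
  · exact hs hst

theorem ae_mem_J_diff_M : ∀ᵐ t ∂volume.restrict D.J, t ∈ D.J \ D.M := by
  have h1 : ∀ᵐ t ∂volume.restrict D.J, t ∈ D.J := ae_restrict_mem isOpen_J.measurableSet
  have h2 : ∀ᵐ t ∂volume.restrict D.J, t ∉ D.M :=
    ae_restrict_of_ae ((countable_range D.x).ae_notMem volume)
  filter_upwards [h1, h2] with t ht1 ht2 using ⟨ht1, ht2⟩

theorem eventually_left (h : D.RegularLeft) : ∀ᶠ s in 𝓝[>] D.a.toReal, s ∈ D.J \ D.M := by
  obtain ⟨a₀, ha, -, hacc⟩ := h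
  have hlt : (a₀ : EReal) < D.b := ha ▸ D.a_lt_b
  rw [ha, EReal.toReal_coe]
  obtain ⟨e, he1, he2⟩ := EReal.lt_iff_exists_real_btwn.1 hlt
  have h1 : ∀ᶠ s in 𝓝[≠] a₀, s ∉ D.M := by
    simpa [accPt_iff_frequently_nhdsNE] using hacc
  have h2 : ∀ᶠ s in 𝓝[>] a₀, s ∉ D.M := h1.filter_mono (nhdsGT_le_nhdsNE a₀)
  filter_upwards [h2, Ioo_mem_nhdsGT (EReal.coe_lt_coe_iff.1 he1)] with s hs1 hs2
  exact ⟨⟨ha ▸ EReal.coe_lt_coe_iff.2 hs2.1, (EReal.coe_lt_coe_iff.2 hs2.2).trans he2⟩, hs1⟩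

theorem eventually_right (h : D.RegularRight) : ∀ᶠ s in 𝓝[<] D.b.toReal, s ∈ D.J \ D.M := by
  obtain ⟨b₀, hb, -, hacc⟩ := h
  have hlt : D.a < (b₀ : EReal) := hb ▸ D.a_lt_b
  rw [hb, EReal.toReal_coe]
  obtain ⟨e, he1, he2⟩ := EReal.lt_iff_exists_real_btwn.1 hlt
  have h1 : ∀ᶠ s in 𝓝[≠] b₀, s ∉ D.M := by
    simpa [accPt_iff_frequently_nhdsNE] using hacc
  have h2 : ∀ᶠ s in 𝓝[<] b₀, s ∉ D.M := h1.filter_mono (nhdsLT_le_nhdsNE b₀)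
  filter_upwards [h2, Ioo_mem_nhdsLT (EReal.coe_lt_coe_iff.1 he2)] with s hs1 hs2
  exact ⟨⟨he1.trans (EReal.coe_lt_coe_iff.2 hs2.1), hb ▸ EReal.coe_lt_coe_iff.2 hs2.2⟩, hs1⟩

namespace IsAdmissible

variable {ω : D.I → ℝ} {u v : ℝ → ℂ}

theorem deriv_add (hu : D.IsAdmissible ω u) (hv : D.IsAdmissible ω v) {t : ℝ}
    (ht : t ∈ D.J \ D.M) : deriv (u + v) t = deriv u t + deriv v t :=
  _root_.deriv_add (hu.differentiable t ht) (hv.differentiable t ht)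

theorem eventually_deriv_add (hu : D.IsAdmissible ω u) (hv : D.IsAdmissible ω v) {l : Filter ℝ}
    (hl : ∀ᶠ s in l, s ∈ D.J \ D.M) : (fun t => deriv u t + deriv v t) =ᶠ[l] deriv (u + v) :=
  hl.mono fun _ ht => (hu.deriv_add hv ht).symm

theorem deriv_smul (c : ℂ) : deriv (c • u) = c • deriv u := by
  ext t
  exact deriv_const_smul_field c u

theorem zero : D.IsAdmissible ω 0 where
  differentiable _ _ := differentiableAt_const 0
  ac c d _ _ := by
    have := ((LipschitzWith.const (0 : ℂ)).lipschitzOnWith (s := uIcc c d)).absolutelyContinuousOnInterval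
    exact this
  ac_deriv c d _ _ := by
    have h : deriv (0 : ℝ → ℂ) = 0 := by ext t; exact deriv_const t 0
    rw [h]
    have := ((LipschitzWith.const (0 : ℂ)).lipschitzOnWith (s := uIcc c d)).absolutelyContinuousOnInterval
    exact this
  continuousAt _ := continuousAt_const
  jump n := by
    have h : deriv (0 : ℝ → ℂ) = fun _ => 0 := by ext t; exact deriv_const t 0
    rw [h]
    exact ⟨0, 0, tendsto_const_nhds, tendsto_const_nhds, by simp⟩

theorem congr_ac {f g : ℝ → ℂ} {c d : ℝ} (hf : AbsolutelyContinuousOnInterval f c d)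
    (hfg : EqOn f g (uIcc c d)) : AbsolutelyContinuousOnInterval g c d := by
  rw [absolutelyContinuousOnInterval_iff] at hf ⊢
  intro ε hε
  obtain ⟨δ, hδ, h⟩ := hf ε hε
  refine ⟨δ, hδ, fun E hE hlen => ?_⟩
  have := h E hE hlen
  refine lt_of_eq_of_lt (Finset.sum_congr rfl fun i hi => ?_) this
  have h2 := hE.1 i hi
  rw [hfg h2.1, hfg h2.2]

theorem add (hu : D.IsAdmissible ω u) (hv : D.IsAdmissible ω v) : D.IsAdmissible ω (u + v) where
  differentiable t ht := (hu.differentiable t ht).add (hv.differentiable t ht)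
  ac c d h hcd := (hu.ac c d h hcd).add (hv.ac c d h hcd)
  ac_deriv c d h hcd := by
    refine congr_ac ((hu.ac_deriv c d h hcd).add (hv.ac_deriv c d h hcd)) fun t ht => ?_
    rw [uIcc_of_le h] at ht
    exact (hu.deriv_add hv (hcd ht)).symm
  continuousAt n := (hu.continuousAt n).add (hv.continuousAt n)
  jump n := by
    obtain ⟨l, r, hl, hr, h⟩ := hu.jump n
    obtain ⟨l', r', hl', hr', h'⟩ := hv.jump n
    have hev := eventually_notMem_M (D.x_mem n)
    refine ⟨l + l', r + r', (hl.add hl').congr' (hu.eventually_deriv_add hv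
      (hev.filter_mono (nhdsLT_le_nhdsNE _))), (hr.add hr').congr' (hu.eventually_deriv_add hv
      (hev.filter_mono (nhdsGT_le_nhdsNE _))), ?_⟩
    simp only [Pi.add_apply]
    linear_combination h + h'

theorem smul (c : ℂ) (hu : D.IsAdmissible ω u) : D.IsAdmissible ω (c • u) where
  differentiable t ht := (hu.differentiable t ht).const_smul c
  ac a b h hab := (hu.ac a b h hab).const_smul c
  ac_deriv a b h hab := by
    rw [deriv_smul]
    exact (hu.ac_deriv a b h hab).const_smul c
  continuousAt n := (hu.continuousAt n).const_smul c
  jump n := by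
    obtain ⟨l, r, hl, hr, h⟩ := hu.jump n
    rw [deriv_smul]
    refine ⟨c * l, c * r, hl.const_mul c, hr.const_mul c, ?_⟩
    simp only [Pi.smul_apply, smul_eq_mul]
    linear_combination c * h

theorem ae_differentiableAt_deriv (hu : D.IsAdmissible ω u) :
    ∀ᵐ t ∂volume.restrict D.J, DifferentiableAt ℝ (deriv u) t := by
  have key : volume {t | t ∈ D.J \ D.M ∧ ¬ DifferentiableAt ℝ (deriv u) t} = 0 := by
    refine measure_null_of_locally_null _ fun t ht => ?_
    obtain ⟨c, d, hc, hd, hcd⟩ := exists_Icc_mem_nhds (isOpen_J_diff_M.mem_nhds ht.1)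
    have hle : c ≤ d := (hc.trans hd).le
    have hbv := (hu.ac_deriv c d hle hcd).boundedVariationOn.locallyBoundedVariationOn
    rw [uIcc_of_le hle] at hbv
    have hae := hbv.ae_differentiableWithinAt_of_mem
    refine ⟨{s | s ∈ Ioo c d ∧ ¬ DifferentiableAt ℝ (deriv u) s}, ?_, ?_⟩
    · filter_upwards [self_mem_nhdsWithin, mem_nhdsWithin_of_mem_nhds (Ioo_mem_nhds hc hd)]
        with s hs1 hs2 using ⟨hs2, hs1.2⟩
    · refine measure_mono_null ?_ hae
      intro s hs hs'
      exact hs.2 ((hs' (Ioo_subset_Icc_self hs.1)).differentiableAt (Icc_mem_nhds hs.1.1 hs.1.2))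
  have h2 : ∀ᵐ t ∂volume.restrict D.J, ¬ (t ∈ D.J \ D.M ∧ ¬ DifferentiableAt ℝ (deriv u) t) :=
    ae_restrict_of_ae (measure_eq_zero_iff_ae_notMem.1 key)
  filter_upwards [h2, ae_mem_J_diff_M] with t ht1 ht2
  by_contra h
  exact ht1 ⟨ht2, h⟩

theorem tau_add (hu : D.IsAdmissible ω u) (hv : D.IsAdmissible ω v) :
    ∀ᵐ t ∂volume.restrict D.J, D.tau (u + v) t = D.tau u t + D.tau v t := by
  filter_upwards [hu.ae_differentiableAt_deriv, hv.ae_differentiableAt_deriv, ae_mem_J_diff_M]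
    with t h1 h2 ht
  have h3 : deriv (u + v) =ᶠ[𝓝 t] deriv u + deriv v :=
    (hu.eventually_deriv_add hv (isOpen_J_diff_M.mem_nhds ht)).symm
  simp only [tau, h3.deriv_eq, _root_.deriv_add h1 h2, Pi.add_apply]
  ring

theorem tau_smul (c : ℂ) (t : ℝ) : D.tau (c • u) t = c * D.tau u t := by
  simp only [tau, deriv_smul, Pi.smul_apply, smul_eq_mul]
  ring

/-- An admissible function which vanishes almost everywhere vanishes on `(a, b) \ M`. -/
theorem eqOn_zero (hu : D.IsAdmissible ω u) (h : u =ᵐ[volume.restrict D.J] 0) :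
    EqOn u 0 (D.J \ D.M) := by
  have h' : u =ᵐ[volume.restrict (D.J \ D.M)] 0 :=
    ae_restrict_of_ae_restrict_of_subset sdiff_subset h
  exact Measure.eqOn_open_of_ae_eq h' isOpen_J_diff_M
    (fun t ht => (hu.differentiable t ht).continuousAt.continuousWithinAt) continuousOn_const

theorem tau_eq_zero (hu : D.IsAdmissible ω u) (h : u =ᵐ[volume.restrict D.J] 0) :
    ∀ᵐ t ∂volume.restrict D.J, D.tau u t = 0 := by
  filter_upwards [ae_mem_J_diff_M] with t ht
  have h1 : ∀ s ∈ D.J \ D.M, u =ᶠ[𝓝 s] fun _ => 0 := fun s hs => by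
    filter_upwards [isOpen_J_diff_M.mem_nhds hs] with r hr using hu.eqOn_zero h hr
  have h2 : deriv u =ᶠ[𝓝 t] fun _ => 0 := by
    filter_upwards [isOpen_J_diff_M.mem_nhds ht] with s hs
    rw [(h1 s hs).deriv_eq, deriv_const]
  simp [tau, h2.deriv_eq, hu.eqOn_zero h ht]

end IsAdmissible

variable (D)

/-- The graph of `H_ω`: all pairs `(f, τ f)` in `L²(a, b)`, where `f` has a representative `u` in
the domain of the maximal operator which satisfies the boundary conditions. -/
def graph (ω : D.I → ℝ) : Submodule ℂ (D.L2 × D.L2) where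
  carrier := {q | ∃ u : ℝ → ℂ, D.IsAdmissible ω u ∧ D.BoundaryLeft u ∧ D.BoundaryRight u ∧
    q.1 =ᵐ[volume.restrict D.J] u ∧ q.2 =ᵐ[volume.restrict D.J] D.tau u}
  zero_mem' := by
    have h0 : deriv (0 : ℝ → ℂ) = fun _ => 0 := by ext t; exact deriv_const t 0
    refine ⟨0, IsAdmissible.zero, fun _ => ⟨0, 0, tendsto_const_nhds, ?_, by simp⟩,
      fun _ => ⟨0, 0, tendsto_const_nhds, ?_, by simp⟩, Lp.coeFn_zero _ _ _, ?_⟩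
    · rw [h0]; exact tendsto_const_nhds
    · rw [h0]; exact tendsto_const_nhds
    · filter_upwards [Lp.coeFn_zero ℂ 2 (volume.restrict D.J)] with t ht
      exact ht.trans (by simp [tau, h0])
  add_mem' := by
    rintro ⟨f, g⟩ ⟨f', g'⟩ ⟨u, hu, ha, hb, h1, h2⟩ ⟨v, hv, ha', hb', h1', h2'⟩
    refine ⟨u + v, hu.add hv, fun hr => ?_, fun hr => ?_, ?_, ?_⟩
    · obtain ⟨y, y', hy, hy', h⟩ := ha hr
      obtain ⟨w, w', hw, hw', h'⟩ := ha' hr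
      refine ⟨y + w, y' + w', hy.add hw, (hy'.add hw').congr'
        (hu.eventually_deriv_add hv (eventually_left hr)), ?_⟩
      linear_combination h + h'
    · obtain ⟨y, y', hy, hy', h⟩ := hb hr
      obtain ⟨w, w', hw, hw', h'⟩ := hb' hr
      refine ⟨y + w, y' + w', hy.add hw, (hy'.add hw').congr'
        (hu.eventually_deriv_add hv (eventually_right hr)), ?_⟩
      linear_combination h + h'
    · exact (Lp.coeFn_add f f').trans (h1.add h1')
    · filter_upwards [Lp.coeFn_add g g', h2, h2', hu.tau_add hv] with t e1 e2 e3 e4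
      rw [e4, ← e2, ← e3]
      exact e1
  smul_mem' := by
    rintro c ⟨f, g⟩ ⟨u, hu, ha, hb, h1, h2⟩
    refine ⟨c • u, hu.smul c, fun hr => ?_, fun hr => ?_, ?_, ?_⟩
    · obtain ⟨y, y', hy, hy', h⟩ := ha hr
      rw [IsAdmissible.deriv_smul]
      exact ⟨c * y, c * y', hy.const_mul c, hy'.const_mul c, by linear_combination c * h⟩
    · obtain ⟨y, y', hy, hy', h⟩ := hb hr
      rw [IsAdmissible.deriv_smul]
      exact ⟨c * y, c * y', hy.const_mul c, hy'.const_mul c, by linear_combination c * h⟩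
    · exact (Lp.coeFn_smul c f).trans (h1.const_smul c)
    · filter_upwards [Lp.coeFn_smul c g, h2] with t e1 e2
      rw [IsAdmissible.tau_smul, ← e2]
      exact e1

theorem graph_single_valued (ω : D.I → ℝ) : ∀ q ∈ D.graph ω, q.1 = 0 → q.2 = 0 := by
  rintro ⟨f, g⟩ ⟨u, hu, -, -, h1, h2⟩ (rfl : f = 0)
  have h3 : u =ᵐ[volume.restrict D.J] 0 := h1.symm.trans (Lp.coeFn_zero _ _ _)
  refine (Lp.eq_zero_iff_ae_eq_zero).2 ?_
  filter_upwards [h2, hu.tau_eq_zero h3] with t e1 e2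
  exact e1.trans e2

/-- The operator `H_ω = -d²/dx² + V + ∑ ω(n) δ(x - xₙ)` in `L²(a, b)`. -/
def operator (ω : D.I → ℝ) : D.L2 →ₗ.[ℂ] D.L2 := (D.graph ω).toLinearPMap

/-- `operator` is the linear operator whose graph is `graph`. -/
theorem operator_graph (ω : D.I → ℝ) : (D.operator ω).graph = D.graph ω :=
  Submodule.toLinearPMap_graph_eq _ (D.graph_single_valued ω)

/-- `A(E)`, the set of all `ω` such that `E` is an eigenvalue of `H_ω`. -/
def A (E : ℝ) : Set (D.I → ℝ) := {ω | IsRealEigenvalue (D.operator ω) E}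

/-- The space `ℝ^I` with the completion of the product `σ`-algebra under `⨉ p n`. -/
abbrev Omega (p : D.I → Measure ℝ) : Type := NullMeasurableSpace (D.I → ℝ) (Measure.infinitePi p)

/-- The completed product measure `ℙ` on `Omega`. -/
abbrev P (p : D.I → Measure ℝ) : Measure (D.Omega p) := (Measure.infinitePi p).completion

end DeltaData

end

/-!
For a fixed energy `E` the eigenfunctions of `H_ω` are the square integrable solutions of
`(τ_ω - E) u = 0` which satisfy the boundary conditions. The proof varies one coupling at a time.

If `ω` and `ω'` differ only in the coupling at `xₙ`, and `u`, `v` are eigenfunctions of `H_ω` and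
`H_ω'` with the eigenvalue `E`, then the Wronskian of `u` and `v` is constant on either side of
`xₙ`. It is zero there: at a regular endpoint because of the boundary condition, at a limit point
endpoint because two independent square integrable solutions would make all solutions square
integrable. On the other hand it jumps by `(ω' n - ω n) u(xₙ) v(xₙ)` at `xₙ`. Hence `u` or `v`
vanishes at `xₙ` (`DeltaData.IsEigenfunction.eq_zero_or_eq_zero`). So the values of one coupling
for which `E` is an eigenvalue form the empty set, a single point, or all of `ℝ`, the last
exactly if the eigenfunction vanishes at `xₙ` and does not feel the interaction.

The couplings have no atoms. If `A(E)` is measurable, Fubini's theorem in each coordinate discards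
all `ω ∈ A(E)` except those whose eigenfunction, which is unique up to a factor, vanishes at every
`xₙ` (`DeltaData.exists_eigenfunction_eq_zero_of_measure_ne_zero`). Therefore, if `A(E)` is not a
null set, there is such an eigenfunction, and it is an eigenfunction of all `H_ω`, so that `A(E)`
is the whole space.

It remains to see that `A(E)` is measurable. For a measurable family, `E` is an eigenvalue of `H_ω`
if and only if the resolution of identity jumps at `E`, which can be tested on a countable dense
set of vectors (`MeasurableFamily.measurableSet_isRealEigenvalue`). For `V = 0` on the line, the
solutions with given Cauchy data at a base point are explicit and depend measurably on `ω`; the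
coefficient of a square integrable combination of two solutions is the limit of a quotient of
integrals over `[-N, N]`, so the existence of such a combination is a measurable condition
(`measurableSet_exists_integrable_sq`). In that case an eigenfunction which vanishes at all
interaction points would be a square integrable solution of `-u'' = E u` on the line, and there is
none (`IsFundamentalPair.eq_zero_of_integrable`).
-/

/-! ### Local properties which hold on deleted neighbourhoods -/

/-- If on a preconnected set `K` a property that holds frequently in the punctured neighbourhood
of a point holds eventually there, then it propagates from one point of `K` to all of `K`. -/
theorem IsPreconnected.eventually_nhdsNE {K : Set ℝ} (hK : IsPreconnected K) {q : ℝ → Prop}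
    (hq : ∀ t ∈ K, (∃ᶠ s in 𝓝[≠] t, q s) → ∀ᶠ s in 𝓝[≠] t, q s)
    {t₀ : ℝ} (ht₀ : t₀ ∈ K) (h₀ : ∃ᶠ s in 𝓝[≠] t₀, q s) {t : ℝ} (ht : t ∈ K) :
    ∀ᶠ s in 𝓝[≠] t, q s := by
  have hopen : IsOpen {r : ℝ | ∀ᶠ s in 𝓝[≠] r, q s} := by
    rw [isOpen_iff_mem_nhds]
    intro r hr
    have h := eventually_eventually_nhdsWithin.2 hr
    rw [eventually_nhdsWithin_iff] at h
    filter_upwards [h] with s hs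
    by_cases hsr : s = r
    · exact hsr ▸ hr
    · have h2 := hs hsr
      rw [nhdsWithin_eq_nhds.2 (isOpen_compl_singleton.mem_nhds hsr)] at h2
      exact h2.filter_mono nhdsWithin_le_nhds
  refine hK.subset_of_closure_inter_subset hopen ⟨t₀, ht₀, hq t₀ ht₀ h₀⟩ ?_ ht
  rintro r ⟨hr, hrK⟩
  by_contra hn
  refine hn (hq r hrK ?_)
  have h1 : ∃ᶠ s in 𝓝 r, ∀ᶠ y in 𝓝[≠] s, q y := mem_closure_iff_frequently.1 hr
  have h2 : ∃ᶠ s in 𝓝[≠] r, ∀ᶠ y in 𝓝[≠] s, q y := by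
    rw [frequently_nhdsWithin_iff]
    refine h1.mono fun s hs => ⟨hs, ?_⟩
    rintro rfl
    exact hn hs
  have h3 : ∃ᶠ s in 𝓝[≠] r, ∃ᶠ y in 𝓝[≠] s, q y := h2.mono fun s hs => hs.frequently
  intro h4
  refine h3 (((eventually_eventually_nhdsWithin.2 h4).and self_mem_nhdsWithin).mono
    fun s hs h5 => h5 ?_)
  have h6 := hs.1
  rw [nhdsWithin_eq_nhds.2 (isOpen_compl_singleton.mem_nhds hs.2)] at h6
  exact h6.filter_mono nhdsWithin_le_nhds

namespace DeltaData

variable {D : DeltaData} {ω ω' : D.I → ℝ} {u v w : ℝ → ℂ} {z : ℂ} {E : ℝ}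

/-! ### One-sided limits of admissible functions -/

open Classical in
/-- The strength of the interaction at the point `t`: it is `ω n` at `xₙ`, and `0` off `M`. -/
noncomputable def strength (ω : D.I → ℝ) (t : ℝ) : ℝ := if h : ∃ n, D.x n = t then ω h.choose else 0

theorem strength_x (ω : D.I → ℝ) (n : D.I) : strength ω (D.x n) = ω n := by
  have h : ∃ m, D.x m = D.x n := ⟨n, rfl⟩
  rw [strength, dif_pos h, D.x_inj h.choose_spec]

theorem strength_of_notMem (ω : D.I → ℝ) {t : ℝ} (ht : t ∉ D.M) : strength ω t = 0 :=
  dif_neg ht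

theorem strength_congr {t : ℝ} (h : ∀ n, D.x n = t → ω n = ω' n) :
    strength ω t = strength ω' t := by
  by_cases ht : t ∈ D.M
  · obtain ⟨n, rfl⟩ := ht
    rw [strength_x, strength_x, h n rfl]
  · rw [strength_of_notMem ω ht, strength_of_notMem ω' ht]

theorem ordConnected_J : OrdConnected D.J :=
  ⟨fun _ hs _ ht _ hr => ⟨hs.1.trans_le (EReal.coe_le_coe_iff.2 hr.1),
    (EReal.coe_le_coe_iff.2 hr.2).trans_lt ht.2⟩⟩

theorem isPreconnected_J : IsPreconnected D.J := ordConnected_J.isPreconnected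

theorem x_mem_J (n : D.I) : D.x n ∈ D.J := D.x_mem n

/-- Around each point of an open subset of `(a, b)` there is an interval in which the point
is the only one that may belong to `M`. -/
theorem exists_Icc_diff_M {K : Set ℝ} (hK : IsOpen K) (hKJ : K ⊆ D.J) {t : ℝ} (ht : t ∈ K) :
    ∃ p q : ℝ, p < t ∧ t < q ∧ Icc p q ⊆ K ∧ ∀ s ∈ Icc p q, s ≠ t → s ∈ K \ D.M := by
  have h := eventually_nhdsWithin_iff.1 (eventually_notMem_M (hKJ ht))
  obtain ⟨p, q, hp, hq, hpq⟩ := exists_Icc_mem_nhds (inter_mem (hK.mem_nhds ht) h)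
  exact ⟨p, q, hp, hq, fun s hs => (hpq hs).1, fun s hs hst => ⟨(hpq hs).1, ((hpq hs).2 hst).2⟩⟩

namespace IsAdmissible

theorem continuousAt_of_mem_J (hu : D.IsAdmissible ω u) {t : ℝ} (ht : t ∈ D.J) :
    ContinuousAt u t := by
  by_cases h : t ∈ D.M
  · obtain ⟨n, rfl⟩ := h
    exact hu.continuousAt n
  · exact (hu.differentiable t ⟨ht, h⟩).continuousAt

theorem continuousAt_deriv (hu : D.IsAdmissible ω u) {t : ℝ} (ht : t ∈ D.J \ D.M) :
    ContinuousAt (deriv u) t := by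
  obtain ⟨c, d, hc, hd, hcd⟩ := exists_Icc_mem_nhds (isOpen_J_diff_M.mem_nhds ht)
  have hle : c ≤ d := (hc.trans hd).le
  have h := (hu.ac_deriv c d hle hcd).continuousOn
  rw [uIcc_of_le hle] at h
  exact h.continuousAt (Icc_mem_nhds hc hd)

/-- The one-sided limits of `u'` at a point of `(a, b)` and the jump condition, uniformly for
points in `M` and off `M`. -/
theorem exists_limits (hu : D.IsAdmissible ω u) {t : ℝ} (ht : t ∈ D.J) :
    ∃ l r : ℂ, Tendsto (deriv u) (𝓝[<] t) (𝓝 l) ∧ Tendsto (deriv u) (𝓝[>] t) (𝓝 r) ∧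
      r - l = (strength ω t : ℂ) * u t := by
  by_cases h : t ∈ D.M
  · obtain ⟨n, rfl⟩ := h
    simpa only [strength_x] using hu.jump n
  · have h1 : Tendsto (deriv u) (𝓝 t) (𝓝 (deriv u t)) := hu.continuousAt_deriv ⟨ht, h⟩
    exact ⟨_, _, h1.mono_left nhdsWithin_le_nhds, h1.mono_left nhdsWithin_le_nhds,
      by simp [strength_of_notMem ω h]⟩

end IsAdmissible

theorem IsSolution.ae_hasDerivAt_deriv (hu : D.IsSolution ω z u) :
    ∀ᵐ t ∂volume.restrict D.J, HasDerivAt (deriv u) (((D.V t : ℂ) - z) * u t) t := by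
  filter_upwards [hu.1.ae_differentiableAt_deriv, hu.2] with t h1 h2
  have h3 : deriv (deriv u) t = ((D.V t : ℂ) - z) * u t := by
    simp only [tau] at h2
    linear_combination -h2
  exact h3 ▸ h1.hasDerivAt

/-! ### The Wronskian -/

/-- The Wronskian `u v' - u' v`. -/
noncomputable def wronskian (u v : ℝ → ℂ) (t : ℝ) : ℂ := u t * deriv v t - deriv u t * v t

theorem wronskian_eq_of_Icc (hu : D.IsSolution ω z u) (hv : D.IsSolution ω' z v) {p q : ℝ}
    (hpq : p ≤ q) (h : Icc p q ⊆ D.J \ D.M) : wronskian u v p = wronskian u v q := by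
  have hac : AbsolutelyContinuousOnInterval (wronskian u v) p q :=
    ((hu.1.ac p q hpq h).fun_smul (hv.1.ac_deriv p q hpq h)).fun_sub
      ((hu.1.ac_deriv p q hpq h).fun_smul (hv.1.ac p q hpq h))
  have hae : ∀ᵐ t, t ∈ uIcc p q → HasDerivAt (wronskian u v) 0 t := by
    have h1 := (ae_restrict_iff' isOpen_J.measurableSet).1 hu.ae_hasDerivAt_deriv
    have h2 := (ae_restrict_iff' isOpen_J.measurableSet).1 hv.ae_hasDerivAt_deriv
    filter_upwards [h1, h2] with t h1 h2 ht
    rw [uIcc_of_le hpq] at ht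
    have htJ := h ht
    have hd := ((hu.1.differentiable t htJ).hasDerivAt.mul (h2 htJ.1)).sub
      ((h1 htJ.1).mul (hv.1.differentiable t htJ).hasDerivAt)
    refine hd.congr_deriv ?_
    ring
  obtain ⟨C, hC⟩ := hac.const_of_ae_hasDerivAt_zero hae
  rw [hC p left_mem_uIcc, hC q right_mem_uIcc]

theorem continuousAt_wronskian (hu : D.IsAdmissible ω u) (hv : D.IsAdmissible ω' v) {t : ℝ}
    (ht : t ∈ D.J \ D.M) : ContinuousAt (wronskian u v) t :=
  ((hu.continuousAt_of_mem_J ht.1).mul (hv.continuousAt_deriv ht)).sub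
    ((hu.continuousAt_deriv ht).mul (hv.continuousAt_of_mem_J ht.1))

/-- The Wronskian is locally constant off `M` (the couplings `ω` and `ω'` may differ), and at a
point `t` it jumps by `(strength ω' t - strength ω t) u(t) v(t)`. -/
theorem exists_wronskian_eventually (hu : D.IsSolution ω z u) (hv : D.IsSolution ω' z v) {t : ℝ}
    (ht : t ∈ D.J) : ∃ l r : ℂ, (∀ᶠ s in 𝓝[<] t, wronskian u v s = l) ∧
      (∀ᶠ s in 𝓝[>] t, wronskian u v s = r) ∧
      r - l = ((strength ω' t : ℂ) - strength ω t) * (u t * v t) := by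
  obtain ⟨p, q, hp, hq, -, hpq⟩ := exists_Icc_diff_M isOpen_J subset_rfl ht
  have hL : ∀ᶠ s in 𝓝[<] t, wronskian u v s = wronskian u v p := by
    filter_upwards [Ioo_mem_nhdsLT hp] with s hs
    exact (wronskian_eq_of_Icc hu hv hs.1.le fun r hr =>
      hpq r ⟨hr.1, hr.2.trans (hs.2.trans hq).le⟩ (hr.2.trans_lt hs.2).ne).symm
  have hR : ∀ᶠ s in 𝓝[>] t, wronskian u v s = wronskian u v q := by
    filter_upwards [Ioo_mem_nhdsGT hq] with s hs
    exact wronskian_eq_of_Icc hu hv hs.2.le fun r hr =>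
      hpq r ⟨(hp.trans hs.1).le.trans hr.1, hr.2⟩ (hs.1.trans_le hr.1).ne'
  refine ⟨_, _, hL, hR, ?_⟩
  obtain ⟨lu, ru, hlu, hru, hju⟩ := hu.1.exists_limits ht
  obtain ⟨lv, rv, hlv, hrv, hjv⟩ := hv.1.exists_limits ht
  have hcu : Tendsto u (𝓝 t) (𝓝 (u t)) := hu.1.continuousAt_of_mem_J ht
  have hcv : Tendsto v (𝓝 t) (𝓝 (v t)) := hv.1.continuousAt_of_mem_J ht
  have eL : wronskian u v p = u t * lv - lu * v t :=
    tendsto_nhds_unique (tendsto_const_nhds.congr' (hL.mono fun s hs => hs.symm))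
      (((hcu.mono_left nhdsWithin_le_nhds).mul hlv).sub
        (hlu.mul (hcv.mono_left nhdsWithin_le_nhds)))
  have eR : wronskian u v q = u t * rv - ru * v t :=
    tendsto_nhds_unique (tendsto_const_nhds.congr' (hR.mono fun s hs => hs.symm))
      (((hcu.mono_left nhdsWithin_le_nhds).mul hrv).sub
        (hru.mul (hcv.mono_left nhdsWithin_le_nhds)))
  rw [eL, eR]
  linear_combination u t * hjv - v t * hju

/-- On a connected open set on which `ω` and `ω'` agree the Wronskian of solutions of
`(τ_ω - z) u = 0` and `(τ_ω' - z) v = 0` is constant. -/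
theorem exists_wronskian_eq (hu : D.IsSolution ω z u) (hv : D.IsSolution ω' z v) {K : Set ℝ}
    (hK : IsPreconnected K) (hKJ : K ⊆ D.J) (hω : ∀ n, D.x n ∈ K → ω n = ω' n) :
    ∃ c : ℂ, ∀ t ∈ K \ D.M, wronskian u v t = c := by
  rcases (K \ D.M).eq_empty_or_nonempty with h | ⟨t₀, ht₀⟩
  · exact ⟨0, by simp [h]⟩
  have hloc : ∀ t ∈ K, ∃ c, ∀ᶠ s in 𝓝[≠] t, wronskian u v s = c := fun t ht => by
    obtain ⟨l, r, hl, hr, h⟩ := exists_wronskian_eventually hu hv (hKJ ht)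
    rw [strength_congr (ω := ω) (ω' := ω') fun n hn => hω n (hn ▸ ht), sub_self, zero_mul,
      sub_eq_zero] at h
    refine ⟨l, ?_⟩
    rw [← nhdsLT_sup_nhdsGT, eventually_sup]
    exact ⟨hl, h ▸ hr⟩
  have hpt : ∀ t ∈ K \ D.M, ∀ᶠ s in 𝓝[≠] t, wronskian u v s = wronskian u v t := fun t ht => by
    obtain ⟨c, hc⟩ := hloc t ht.1
    have h := (continuousAt_wronskian hu.1 hv.1 ⟨hKJ ht.1, ht.2⟩).tendsto
    have h2 : wronskian u v t = c := tendsto_nhds_unique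
      (h.mono_left (nhdsWithin_le_nhds (s := {t}ᶜ))) (tendsto_const_nhds.congr'
        (hc.mono fun s hs => hs.symm))
    exact h2 ▸ hc
  refine ⟨wronskian u v t₀, fun t ht => ?_⟩
  have h1 := hK.eventually_nhdsNE (q := fun s => wronskian u v s = wronskian u v t₀)
    (fun s hs hf => ?_) ht₀.1 (hpt t₀ ht₀).frequently ht.1
  · obtain ⟨s, hs1, hs2⟩ := (h1.and (hpt t ht)).exists
    exact hs2.symm.trans hs1
  · obtain ⟨c, hc⟩ := hloc s hs
    obtain ⟨r, hr1, hr2⟩ := (hf.and_eventually hc).exists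
    exact hc.mono fun y hy => by rw [hy, ← hr2, hr1]

/-- Two solutions which are square integrable on `K` have Wronskian zero there, if some solution is
not square integrable on `K`; otherwise the latter would be a combination of the two. The couplings
need only agree on `K`. -/
theorem wronskian_eq_zero_of_not_memLp {ω₁ ω₂ ω₃ : D.I → ℝ} (hu : D.IsSolution ω₁ z u)
    (hv : D.IsSolution ω₂ z v) (hw : D.IsSolution ω₃ z w) {K : Set ℝ} (hK : IsPreconnected K)
    (hKo : IsOpen K) (hKJ : K ⊆ D.J) (h12 : ∀ n, D.x n ∈ K → ω₁ n = ω₂ n)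
    (h23 : ∀ n, D.x n ∈ K → ω₂ n = ω₃ n) (hu2 : MemLp u 2 (volume.restrict K))
    (hv2 : MemLp v 2 (volume.restrict K)) (hw2 : ¬ MemLp w 2 (volume.restrict K)) :
    ∀ t ∈ K \ D.M, wronskian u v t = 0 := by
  obtain ⟨c, hc⟩ := exists_wronskian_eq hu hv hK hKJ h12
  obtain ⟨d, hd⟩ := exists_wronskian_eq hv hw hK hKJ h23
  obtain ⟨e, he⟩ := exists_wronskian_eq hw hu hK hKJ fun n hn =>
    ((h12 n hn).trans (h23 n hn)).symm
  by_cases h0 : c = 0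
  · exact h0 ▸ hc
  refine absurd ?_ hw2
  have h1 : MemLp ((-(d / c)) • u + (-(e / c)) • v) 2 (volume.restrict K) :=
    (hu2.const_smul _).add (hv2.const_smul _)
  refine h1.ae_eq ?_
  have hM : ∀ᵐ t ∂volume.restrict K, t ∉ D.M :=
    ae_restrict_of_ae ((countable_range D.x).ae_notMem volume)
  filter_upwards [ae_restrict_mem hKo.measurableSet, hM] with t ht1 ht2
  have e1 := hc t ⟨ht1, ht2⟩
  have e2 := hd t ⟨ht1, ht2⟩
  have e3 := he t ⟨ht1, ht2⟩
  simp only [wronskian] at e1 e2 e3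
  -- `w W(u,v) + u W(v,w) + v W(w,u) = 0` is a determinant with two equal rows.
  have key : w t * c + u t * d + v t * e = 0 := by rw [← e1, ← e2, ← e3]; ring
  simp only [Pi.add_apply, Pi.smul_apply, smul_eq_mul]
  field_simp
  linear_combination -key

/-- Two solutions which satisfy the same boundary condition at an end of `K`, described by the
filter `l`, have Wronskian zero on `K`. -/
theorem wronskian_eq_zero_of_boundary (hu : D.IsSolution ω z u) (hv : D.IsSolution ω' z v)
    {K : Set ℝ} (hK : IsPreconnected K) (hKJ : K ⊆ D.J) (hω : ∀ n, D.x n ∈ K → ω n = ω' n)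
    {l : Filter ℝ} [l.NeBot] (hl : ∀ᶠ s in l, s ∈ K \ D.M) (φ : ℝ)
    (hbu : ∃ y y' : ℂ, Tendsto u l (𝓝 y) ∧ Tendsto (deriv u) l (𝓝 y') ∧
      y * (Real.cos φ : ℂ) + y' * (Real.sin φ : ℂ) = 0)
    (hbv : ∃ y y' : ℂ, Tendsto v l (𝓝 y) ∧ Tendsto (deriv v) l (𝓝 y') ∧
      y * (Real.cos φ : ℂ) + y' * (Real.sin φ : ℂ) = 0) :
    ∀ t ∈ K \ D.M, wronskian u v t = 0 := by
  obtain ⟨c, hc⟩ := exists_wronskian_eq hu hv hK hKJ hω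
  obtain ⟨y, y', hy, hy', h⟩ := hbu
  obtain ⟨x, x', hx, hx', h'⟩ := hbv
  have h1 : Tendsto (wronskian u v) l (𝓝 (y * x' - y' * x)) := (hy.mul hx').sub (hy'.mul hx)
  have h2 : c = y * x' - y' * x := tendsto_nhds_unique
    (tendsto_const_nhds.congr' (hl.mono fun s hs => (hc s hs).symm)) h1
  have h3 : (Real.cos φ : ℂ) ^ 2 + (Real.sin φ : ℂ) ^ 2 = 1 := by
    exact_mod_cast Real.cos_sq_add_sin_sq φ
  have h4 : c = 0 := by
    rw [h2]
    linear_combination (-(y * x' - y' * x)) * h3 + (Real.cos φ * x' - Real.sin φ * x) * h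
      + (Real.sin φ * y - Real.cos φ * y') * h'
  exact h4 ▸ hc

/-! ### Unique solvability of the initial value problem -/


theorem integrableOn_V (D : DeltaData) {p q : ℝ} (h : Icc p q ⊆ D.J) :
    IntegrableOn D.V (Icc p q) :=
  D.V_loc.integrableOn_compact_subset h isCompact_Icc

theorem integrableOn_one_add_abs (D : DeltaData) (E : ℝ) {p q : ℝ} (h : Icc p q ⊆ D.J) :
    IntegrableOn (fun t => 1 + |D.V t - E|) (Icc p q) := by
  have h1 : ∀ c : ℝ, IntegrableOn (fun _ => c) (Icc p q) := fun c => by simp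
  exact (h1 1).add ((D.integrableOn_V h).sub (h1 E)).abs

theorem _root_.AbsolutelyContinuousOnInterval.of_dist_le {X Y : Type*} [PseudoMetricSpace X]
    [PseudoMetricSpace Y] {f : ℝ → X} {g : ℝ → Y} {p q : ℝ}
    (hf : AbsolutelyContinuousOnInterval f p q) (h : ∀ s t, dist (g s) (g t) ≤ dist (f s) (f t)) :
    AbsolutelyContinuousOnInterval g p q := by
  rw [absolutelyContinuousOnInterval_iff] at hf ⊢
  intro ε hε
  obtain ⟨δ, hδ, hd⟩ := hf ε hε
  exact ⟨δ, hδ, fun I hI hlen =>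
    (Finset.sum_le_sum fun i _ => h _ _).trans_lt (hd I hI hlen)⟩

theorem _root_.AbsolutelyContinuousOnInterval.norm_sq {f : ℝ → ℂ} {p q : ℝ}
    (hf : AbsolutelyContinuousOnInterval f p q) :
    AbsolutelyContinuousOnInterval (fun t => ‖f t‖ ^ 2) p q := by
  have h1 : AbsolutelyContinuousOnInterval (fun t => ‖f t‖) p q :=
    hf.of_dist_le fun s t => (dist_norm_norm_le _ _).trans_eq (dist_eq_norm _ _).symm
  simpa only [sq] using h1.fun_mul h1

/-- The quantity `|u|² + |u'|²` of a solution changes at most by the factor `2` over an interval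
on which `1 + |V - E|` has integral at most `1/2`. -/
theorem IsSolution.energy_le (hu : D.IsSolution ω E u) {p q : ℝ} (hpq : p ≤ q)
    (h : Icc p q ⊆ D.J \ D.M) (hI : ∫ t in Icc p q, (1 + |D.V t - E|) ≤ 1 / 2) {s t : ℝ}
    (hs : s ∈ Icc p q) (ht : t ∈ Icc p q) :
    ‖u t‖ ^ 2 + ‖deriv u t‖ ^ 2 ≤ 2 * (‖u s‖ ^ 2 + ‖deriv u s‖ ^ 2) := by
  set e : ℝ → ℝ := fun r => ‖u r‖ ^ 2 + ‖deriv u r‖ ^ 2 with he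
  have hac : AbsolutelyContinuousOnInterval e p q :=
    (hu.1.ac p q hpq h).norm_sq.fun_add (hu.1.ac_deriv p q hpq h).norm_sq
  have hae : ∀ᵐ r, r ∈ Icc p q → |deriv e r| ≤ (1 + |D.V r - E|) * e r := by
    filter_upwards [(ae_restrict_iff' isOpen_J.measurableSet).1 hu.ae_hasDerivAt_deriv]
      with r h1 hr
    have hrJ := h hr
    have hd := (hu.1.differentiable r hrJ).hasDerivAt.norm_sq.add (h1 hrJ.1).norm_sq
    have hd' : HasDerivAt e _ r := hd
    rw [hd'.deriv, ← mul_add, abs_mul, abs_two]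
    have b1 : |inner ℝ (u r) (deriv u r)| ≤ ‖u r‖ * ‖deriv u r‖ := abs_real_inner_le_norm _ _
    have b2 : |inner ℝ (deriv u r) (((D.V r : ℂ) - (E : ℂ)) * u r)| ≤
        ‖deriv u r‖ * (|D.V r - E| * ‖u r‖) := by
      refine (abs_real_inner_le_norm _ _).trans_eq ?_
      rw [norm_mul, ← Complex.ofReal_sub, Complex.norm_real, Real.norm_eq_abs]
    have b3 := abs_add_le (inner ℝ (u r) (deriv u r))
      (inner ℝ (deriv u r) (((D.V r : ℂ) - (E : ℂ)) * u r))
    have b4 : 2 * (‖u r‖ * ‖deriv u r‖) ≤ e r := by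
      simp only [he]
      nlinarith [sq_nonneg (‖u r‖ - ‖deriv u r‖)]
    have b5 : 0 ≤ 1 + |D.V r - E| := by positivity
    nlinarith [mul_le_mul_of_nonneg_left b4 b5]
  have hcont : ContinuousOn e (Icc p q) := by
    have := hac.continuousOn
    rwa [uIcc_of_le hpq] at this
  obtain ⟨m, hm, hmax⟩ := isCompact_Icc.exists_isMaxOn (nonempty_Icc.2 hpq) hcont
  have hk := D.integrableOn_one_add_abs E (h.trans sdiff_subset)
  have hdi : IntegrableOn (deriv e) (Icc p q) :=
    (intervalIntegrable_iff_integrableOn_Icc_of_le hpq).1 hac.intervalIntegrable_deriv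
  have hmnn : 0 ≤ e m := by positivity
  -- With `m` a maximum point of `e`, the bound `|e'| ≤ (1 + |V - E|) e(m)` is integrated from `s`
  -- to `m`.
  have hsm : e m - e s ≤ e m / 2 := by
    have hsub : uIcc s m ⊆ Icc p q := uIcc_subset_Icc hs hm
    have hftc : ∫ r in s..m, deriv e r = e m - e s :=
      (hac.mono (by rwa [uIcc_of_le hpq])).integral_deriv_eq_sub
    calc e m - e s ≤ ‖∫ r in s..m, deriv e r‖ := by rw [hftc]; exact le_abs_self _
      _ ≤ ∫ r in uIoc s m, ‖deriv e r‖ := intervalIntegral.norm_integral_le_integral_norm_uIoc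
      _ ≤ ∫ r in Icc p q, ‖deriv e r‖ := setIntegral_mono_set hdi.norm
          (Eventually.of_forall fun _ => norm_nonneg _)
          (uIoc_subset_uIcc.trans hsub).eventuallyLE
      _ ≤ ∫ r in Icc p q, (1 + |D.V r - E|) * e m := by
          refine integral_mono_ae hdi.norm (hk.mul_const _) ?_
          filter_upwards [(ae_restrict_iff' measurableSet_Icc).2 hae,
            ae_restrict_mem measurableSet_Icc] with r hr hr'
          exact hr.trans (mul_le_mul_of_nonneg_left (hmax hr') (by positivity))
      _ ≤ e m / 2 := by
          rw [integral_mul_const]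
          nlinarith
  have := hmax ht
  simp only [mem_ofPred_eq] at this
  change e t ≤ 2 * e s
  linarith

/-- In a neighbourhood of any point of `(a, b)` the integral of `1 + |V - E|` is small. -/
theorem exists_Icc_integral_le (D : DeltaData) (E : ℝ) {t : ℝ} (ht : t ∈ D.J) :
    ∃ p q : ℝ, p < t ∧ t < q ∧ (∀ s ∈ Icc p q, s ≠ t → s ∈ D.J \ D.M) ∧
      ∀ p' q', Icc p' q' ⊆ Icc p q → ∫ s in Icc p' q', (1 + |D.V s - E|) ≤ 1 / 2 := by
  obtain ⟨p, q, hp, hq, hK, hpq⟩ := exists_Icc_diff_M isOpen_J subset_rfl ht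
  have hint := D.integrableOn_one_add_abs E hK
  have hlim : Tendsto (fun δ : ℝ => ∫ s in Icc (t - δ) (t + δ), (1 + |D.V s - E|)
      ∂volume.restrict (Icc p q)) (𝓝[>] 0) (𝓝 0) := by
    have hv : Tendsto (fun δ : ℝ => (volume.restrict (Icc p q)) (Icc (t - δ) (t + δ)))
        (𝓝[>] 0) (𝓝 0) := by
      have h1 : Tendsto (fun δ : ℝ => ENNReal.ofReal (t + δ - (t - δ))) (𝓝[>] 0) (𝓝 0) := by
        have h2 : Tendsto (fun δ : ℝ => ENNReal.ofReal (t + δ - (t - δ))) (𝓝 0)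
            (𝓝 (ENNReal.ofReal (t + 0 - (t - 0)))) :=
          (ENNReal.continuous_ofReal.comp (by fun_prop)).tendsto 0
        simp only [add_zero, sub_zero, sub_self, ENNReal.ofReal_zero] at h2
        exact h2.mono_left nhdsWithin_le_nhds
      refine tendsto_of_tendsto_of_tendsto_of_le_of_le tendsto_const_nhds h1
        (fun _ => zero_le) fun δ => ?_
      rw [← Real.volume_Icc]
      exact Measure.restrict_apply_le _ _
    exact hint.tendsto_setIntegral_nhds_zero hv
  have hev := (hlim.eventually (gt_mem_nhds (show (0 : ℝ) < 1 / 2 by norm_num))).and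
    (Ioo_mem_nhdsGT (show (0 : ℝ) < min (t - p) (q - t) by
      exact lt_min (by linarith) (by linarith)))
  obtain ⟨δ, h1, h2, h3⟩ := hev.exists
  have hδ1 := h3.trans_le (min_le_left _ _)
  have hδ2 := h3.trans_le (min_le_right _ _)
  have hsub : Icc (t - δ) (t + δ) ⊆ Icc p q := Icc_subset_Icc (by linarith) (by linarith)
  refine ⟨t - δ, t + δ, by linarith, by linarith, fun s hs hst => hpq s (hsub hs) hst,
    fun p' q' h' => ?_⟩
  rw [Measure.restrict_restrict measurableSet_Icc, inter_eq_left.2 hsub] at h1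
  exact (setIntegral_mono_set (hint.mono_set hsub)
    (Eventually.of_forall fun _ => by positivity) h'.eventuallyLE).trans h1.le

/-- A solution with vanishing one-sided Cauchy data at a point of `(a, b)` vanishes near it. -/
theorem IsSolution.eventually_eq_zero (hu : D.IsSolution ω E u) {t : ℝ} (ht : t ∈ D.J)
    (h : u t = 0) (hd : Tendsto (deriv u) (𝓝[<] t) (𝓝 0) ∨ Tendsto (deriv u) (𝓝[>] t) (𝓝 0)) :
    ∀ᶠ s in 𝓝[≠] t, u s = 0 ∧ deriv u s = 0 := by
  obtain ⟨l, r, hl, hr, hj⟩ := hu.1.exists_limits ht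
  rw [h, mul_zero, sub_eq_zero] at hj
  obtain ⟨rfl, rfl⟩ : l = 0 ∧ r = 0 := by
    rcases hd with hd | hd
    · have := tendsto_nhds_unique hl hd
      exact ⟨this, hj.trans this⟩
    · have := tendsto_nhds_unique hr hd
      exact ⟨hj.symm.trans this, this⟩
  have hcu : Tendsto u (𝓝 t) (𝓝 0) := h ▸ hu.1.continuousAt_of_mem_J ht
  have hlim : ∀ l' : Filter ℝ, l' ≤ 𝓝 t → Tendsto (deriv u) l' (𝓝 0) →
      Tendsto (fun s => 2 * (‖u s‖ ^ 2 + ‖deriv u s‖ ^ 2)) l' (𝓝 0) := fun l' h1 h2 => by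
    have := (((hcu.mono_left h1).norm.pow 2).add (h2.norm.pow 2)).const_mul 2
    simpa using this
  have hzero : ∀ s, ‖u s‖ ^ 2 + ‖deriv u s‖ ^ 2 ≤ 0 → u s = 0 ∧ deriv u s = 0 := fun s hs => by
    constructor
    · rw [← norm_eq_zero]; nlinarith [sq_nonneg ‖u s‖, sq_nonneg ‖deriv u s‖]
    · rw [← norm_eq_zero]; nlinarith [sq_nonneg ‖u s‖, sq_nonneg ‖deriv u s‖]
  obtain ⟨p, q, hp, hq, hpq, hI⟩ := D.exists_Icc_integral_le E ht
  rw [← nhdsLT_sup_nhdsGT, eventually_sup]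
  constructor
  · filter_upwards [Ioo_mem_nhdsLT hp] with s hs
    refine hzero s (ge_of_tendsto (hlim _ nhdsWithin_le_nhds hl) ?_)
    filter_upwards [Ioo_mem_nhdsLT hs.2] with y hy
    have hsub : Icc s y ⊆ Icc p q := Icc_subset_Icc hs.1.le (hy.2.trans hq).le
    exact hu.energy_le hy.1.le (fun x hx => hpq x (hsub hx) (hx.2.trans_lt hy.2).ne)
      (hI _ _ hsub) ⟨hy.1.le, le_rfl⟩ ⟨le_rfl, hy.1.le⟩
  · filter_upwards [Ioo_mem_nhdsGT hq] with s hs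
    refine hzero s (ge_of_tendsto (hlim _ nhdsWithin_le_nhds hr) ?_)
    filter_upwards [Ioo_mem_nhdsGT hs.1] with y hy
    have hsub : Icc y s ⊆ Icc p q := Icc_subset_Icc (hp.trans hy.1).le hs.2.le
    exact hu.energy_le hy.2.le (fun x hx => hpq x (hsub hx) (hy.1.trans_le hx.1).ne')
      (hI _ _ hsub) ⟨le_rfl, hy.2.le⟩ ⟨hy.2.le, le_rfl⟩

/-- Zeros of the Cauchy data which accumulate at a point of `(a, b)` make the one-sided Cauchy data
at that point vanish. -/
theorem IsSolution.eventually_eq_zero_of_frequently (hu : D.IsSolution ω E u) {t : ℝ}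
    (ht : t ∈ D.J) (h : ∃ᶠ s in 𝓝[≠] t, u s = 0 ∧ deriv u s = 0) :
    ∀ᶠ s in 𝓝[≠] t, u s = 0 ∧ deriv u s = 0 := by
  obtain ⟨l, r, hl, hr, hj⟩ := hu.1.exists_limits ht
  have hcu : Tendsto u (𝓝 t) (𝓝 (u t)) := hu.1.continuousAt_of_mem_J ht
  have hfreq : ∀ {l' : Filter ℝ} {f : ℝ → ℂ} {c : ℂ}, Tendsto f l' (𝓝 c) →
      (∃ᶠ s in l', f s = 0) → c = 0 := fun {l' f c} h1 h2 =>
    isClosed_singleton.mem_of_frequently_of_tendsto (h2.mono fun s hs => mem_singleton_iff.2 hs) h1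
  rw [← nhdsLT_sup_nhdsGT, frequently_sup] at h
  rcases h with h | h
  · exact hu.eventually_eq_zero ht (hfreq (hcu.mono_left nhdsWithin_le_nhds)
      (h.mono fun s hs => hs.1)) (Or.inl ((hfreq hl (h.mono fun s hs => hs.2)) ▸ hl))
  · exact hu.eventually_eq_zero ht (hfreq (hcu.mono_left nhdsWithin_le_nhds)
      (h.mono fun s hs => hs.1)) (Or.inr ((hfreq hr (h.mono fun s hs => hs.2)) ▸ hr))

/-- A solution with vanishing one-sided Cauchy data at a point of `(a, b)` vanishes. -/
theorem IsSolution.eq_zero (hu : D.IsSolution ω E u) {t : ℝ} (ht : t ∈ D.J)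
    (h : u t = 0) (hd : Tendsto (deriv u) (𝓝[<] t) (𝓝 0) ∨ Tendsto (deriv u) (𝓝[>] t) (𝓝 0))
    {s : ℝ} (hs : s ∈ D.J) : u s = 0 := by
  have h1 := isPreconnected_J.eventually_nhdsNE (q := fun s => u s = 0 ∧ deriv u s = 0)
    (fun r hr hf => hu.eventually_eq_zero_of_frequently hr hf) ht
    (hu.eventually_eq_zero ht h hd).frequently hs
  exact tendsto_nhds_unique
    ((hu.1.continuousAt_of_mem_J hs).tendsto.mono_left (nhdsWithin_le_nhds (s := {s}ᶜ)))
    (tendsto_const_nhds.congr' (h1.mono fun y hy => hy.1.symm))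

end DeltaData

namespace DeltaData

variable {D : DeltaData} {ω ω' : D.I → ℝ} {u v : ℝ → ℂ} {E : ℝ}

/-! ### Eigenfunctions and the variation of one coupling -/

variable (D) in
/-- `u` is an eigenfunction of `H_ω` with eigenvalue `E`: a nonzero square integrable solution
of `(τ_ω - E) u = 0` which satisfies the boundary conditions. -/
structure IsEigenfunction (ω : D.I → ℝ) (E : ℝ) (u : ℝ → ℂ) : Prop where
  sol : D.IsSolution ω E u
  memLp : MemLp u 2 (volume.restrict D.J)
  left : D.BoundaryLeft u
  right : D.BoundaryRight u
  exists_ne : ∃ t ∈ D.J, u t ≠ 0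

theorem IsAdmissible.eq_zero_of_ae (hu : D.IsAdmissible ω u) (h : u =ᵐ[volume.restrict D.J] 0)
    {t : ℝ} (ht : t ∈ D.J) : u t = 0 :=
  tendsto_nhds_unique
    ((hu.continuousAt_of_mem_J ht).tendsto.mono_left (nhdsWithin_le_nhds (s := {t}ᶜ)))
    (tendsto_const_nhds.congr' ((eventually_notMem_M ht).mono fun _ hy =>
      (hu.eqOn_zero h hy).symm))

theorem mem_A_iff : ω ∈ D.A E ↔ ∃ u, D.IsEigenfunction ω E u := by
  constructor
  · rintro ⟨ψ, h0, hψ⟩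
    have hg : ((ψ : D.L2), D.operator ω ψ) ∈ D.graph ω := by
      rw [← D.operator_graph]
      exact LinearPMap.mem_graph _ ψ
    obtain ⟨u, hu, hl, hr, h1, h2⟩ := hg
    simp only at h1 h2
    refine ⟨u, ⟨hu, ?_⟩, (memLp_congr_ae h1).1 (Lp.memLp _), hl, hr, ?_⟩
    · rw [hψ] at h2
      filter_upwards [h1, h2, Lp.coeFn_smul (E : ℂ) (ψ : D.L2)] with t e1 e2 e3
      rw [← e2, e3, ← e1]
      simp
    · by_contra! hc
      refine h0 (Lp.eq_zero_iff_ae_eq_zero.2 (h1.trans ?_))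
      filter_upwards [ae_restrict_mem isOpen_J.measurableSet] with t ht using hc t ht
  · rintro ⟨u, hu⟩
    set f : D.L2 := hu.memLp.toLp u with hf
    have h1 : f =ᵐ[volume.restrict D.J] u := hu.memLp.coeFn_toLp
    have hg : (f, (E : ℂ) • f) ∈ D.graph ω := by
      refine ⟨u, hu.sol.1, hu.left, hu.right, h1, ?_⟩
      filter_upwards [h1, hu.sol.2, Lp.coeFn_smul (E : ℂ) f] with t e1 e2 e3
      refine e3.trans ?_
      rw [Pi.smul_apply, e1, smul_eq_mul]
      linear_combination -e2
    rw [← D.operator_graph, LinearPMap.mem_graph_iff] at hg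
    obtain ⟨ψ, e1, e2⟩ := hg
    simp only at e1 e2
    refine ⟨ψ, fun h0 => ?_, by rw [e2, e1]⟩
    obtain ⟨t, ht, hne⟩ := hu.exists_ne
    refine hne (hu.sol.1.eq_zero_of_ae (h1.symm.trans ?_) ht)
    rw [← e1, h0]
    exact Lp.coeFn_zero _ _ _

theorem isPreconnected_J_inter_Iio (d : ℝ) : IsPreconnected (D.J ∩ Iio d) :=
  (ordConnected_J.inter ordConnected_Iio).isPreconnected

theorem isPreconnected_J_inter_Ioi (d : ℝ) : IsPreconnected (D.J ∩ Ioi d) :=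
  (ordConnected_J.inter ordConnected_Ioi).isPreconnected

/-- Eigenfunctions for couplings which agree to the left of `d` have Wronskian zero there. -/
theorem IsEigenfunction.wronskian_eq_zero_left (hD : D.LimitPointOrRegular)
    (hu : D.IsEigenfunction ω E u) (hv : D.IsEigenfunction ω' E v) {d : ℝ} (hd : d ∈ D.J)
    (hω : ∀ n, D.x n < d → ω n = ω' n) :
    ∀ t ∈ (D.J ∩ Iio d) \ D.M, wronskian u v t = 0 := by
  rcases (hD ω).1 with h | h
  · obtain ⟨w, hw, hw2⟩ := h E
    refine wronskian_eq_zero_of_not_memLp hu.sol hv.sol hw (isPreconnected_J_inter_Iio d)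
      (isOpen_J.inter isOpen_Iio) inter_subset_left (fun n hn => hω n hn.2)
      (fun n hn => (hω n hn.2).symm)
      (hu.memLp.mono_measure (Measure.restrict_mono inter_subset_left le_rfl))
      (hv.memLp.mono_measure (Measure.restrict_mono inter_subset_left le_rfl))
      fun h => hw2 ⟨d, hd, h⟩
  · refine wronskian_eq_zero_of_boundary hu.sol hv.sol (isPreconnected_J_inter_Iio d)
      inter_subset_left (fun n hn => hω n hn.2) ?_ D.θ (hu.left h) (hv.left h)
    have hlt : D.a.toReal < d := by
      obtain ⟨a₀, ha, -⟩ := h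
      have := hd.1
      rw [ha] at this ⊢
      exact EReal.coe_lt_coe_iff.1 this
    filter_upwards [eventually_left h, Ioo_mem_nhdsGT hlt] with s hs1 hs2
      using ⟨⟨hs1.1, hs2.2⟩, hs1.2⟩

/-- Eigenfunctions for couplings which agree to the right of `d` have Wronskian zero there. -/
theorem IsEigenfunction.wronskian_eq_zero_right (hD : D.LimitPointOrRegular)
    (hu : D.IsEigenfunction ω E u) (hv : D.IsEigenfunction ω' E v) {d : ℝ} (hd : d ∈ D.J)
    (hω : ∀ n, d < D.x n → ω n = ω' n) :
    ∀ t ∈ (D.J ∩ Ioi d) \ D.M, wronskian u v t = 0 := by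
  rcases (hD ω).2 with h | h
  · obtain ⟨w, hw, hw2⟩ := h E
    refine wronskian_eq_zero_of_not_memLp hu.sol hv.sol hw (isPreconnected_J_inter_Ioi d)
      (isOpen_J.inter isOpen_Ioi) inter_subset_left (fun n hn => hω n hn.2)
      (fun n hn => (hω n hn.2).symm)
      (hu.memLp.mono_measure (Measure.restrict_mono inter_subset_left le_rfl))
      (hv.memLp.mono_measure (Measure.restrict_mono inter_subset_left le_rfl))
      fun h => hw2 ⟨d, hd, h⟩
  · refine wronskian_eq_zero_of_boundary hu.sol hv.sol (isPreconnected_J_inter_Ioi d)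
      inter_subset_left (fun n hn => hω n hn.2) ?_ D.γ (hu.right h) (hv.right h)
    have hlt : d < D.b.toReal := by
      obtain ⟨b₀, hb, -⟩ := h
      have := hd.2
      rw [hb] at this ⊢
      exact EReal.coe_lt_coe_iff.1 this
    filter_upwards [eventually_right h, Ioo_mem_nhdsLT hlt] with s hs1 hs2
      using ⟨⟨hs1.1, hs2.1⟩, hs1.2⟩

/-- If `E` is an eigenvalue for two values of the coupling at `xₙ`, the other couplings being
fixed, then one of the eigenfunctions vanishes at `xₙ`: the Wronskian vanishes on both sides of
`xₙ`, while it jumps by a nonzero multiple of `u(xₙ) v(xₙ)`. -/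
theorem IsEigenfunction.eq_zero_or_eq_zero (hD : D.LimitPointOrRegular)
    (hu : D.IsEigenfunction ω E u) (hv : D.IsEigenfunction ω' E v) {n : D.I}
    (hω : ∀ m, m ≠ n → ω m = ω' m) (hn : ω n ≠ ω' n) : u (D.x n) = 0 ∨ v (D.x n) = 0 := by
  have hL := hu.wronskian_eq_zero_left hD hv (x_mem_J n)
    fun m hm => hω m (by rintro rfl; simp at hm)
  have hR := hu.wronskian_eq_zero_right hD hv (x_mem_J n)
    fun m hm => hω m (by rintro rfl; simp at hm)
  obtain ⟨l, r, hl, hr, h⟩ := exists_wronskian_eventually hu.sol hv.sol (x_mem_J n)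
  have hev := eventually_notMem_M (x_mem_J n)
  obtain ⟨s, hs1, hs2, hs3⟩ := (hl.and ((hev.filter_mono (nhdsLT_le_nhdsNE _)).and
    self_mem_nhdsWithin)).exists
  obtain ⟨y, hy1, hy2, hy3⟩ := (hr.and ((hev.filter_mono (nhdsGT_le_nhdsNE _)).and
    self_mem_nhdsWithin)).exists
  rw [← hs1, ← hy1, hL s ⟨⟨hs2.1, hs3⟩, hs2.2⟩, hR y ⟨⟨hy2.1, hy3⟩, hy2.2⟩, sub_zero, strength_x,
    strength_x] at h
  have hne : (ω' n : ℂ) - (ω n : ℂ) ≠ 0 := by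
    rw [sub_ne_zero]
    exact_mod_cast hn.symm
  simpa [hne] using h.symm

/-- Eigenfunctions of the same `H_ω` for the same eigenvalue have the same zeros: their Wronskian
vanishes, and at a zero of a nonzero solution its one-sided derivatives do not. -/
theorem IsEigenfunction.eq_zero_of_eq_zero (hD : D.LimitPointOrRegular)
    (hu : D.IsEigenfunction ω E u) (hv : D.IsEigenfunction ω E v) {t : ℝ} (ht : t ∈ D.J)
    (h : u t = 0) : v t = 0 := by
  have hL := hu.wronskian_eq_zero_left hD hv ht fun m hm => rfl
  obtain ⟨l, r, hl, hr, hj⟩ := hu.sol.1.exists_limits ht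
  obtain ⟨l', r', hl', -, -⟩ := hv.sol.1.exists_limits ht
  have hcu := (hu.sol.1.continuousAt_of_mem_J ht).tendsto.mono_left
    (nhdsWithin_le_nhds (s := Iio t))
  have hcv := (hv.sol.1.continuousAt_of_mem_J ht).tendsto.mono_left
    (nhdsWithin_le_nhds (s := Iio t))
  have hW : Tendsto (wronskian u v) (𝓝[<] t) (𝓝 (u t * l' - l * v t)) :=
    (hcu.mul hl').sub (hl.mul hcv)
  have h0 : u t * l' - l * v t = 0 := by
    refine tendsto_nhds_unique hW (tendsto_const_nhds.congr' ?_)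
    filter_upwards [(eventually_notMem_M ht).filter_mono (nhdsLT_le_nhdsNE _),
      self_mem_nhdsWithin] with s hs1 hs2
    exact (hL s ⟨⟨hs1.1, hs2⟩, hs1.2⟩).symm
  rw [h, zero_mul, zero_sub, neg_eq_zero, mul_eq_zero] at h0
  refine h0.resolve_left ?_
  rintro rfl
  obtain ⟨s, hs, hne⟩ := hu.exists_ne
  exact hne (hu.sol.eq_zero ht h (Or.inl hl) hs)

/-- A coupling at a zero of a solution is not felt by the solution. -/
theorem IsAdmissible.congr_coupling (hu : D.IsAdmissible ω u)
    (h : ∀ n, ω n = ω' n ∨ u (D.x n) = 0) : D.IsAdmissible ω' u where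
  differentiable := hu.differentiable
  ac := hu.ac
  ac_deriv := hu.ac_deriv
  continuousAt := hu.continuousAt
  jump n := by
    obtain ⟨l, r, hl, hr, hj⟩ := hu.jump n
    refine ⟨l, r, hl, hr, ?_⟩
    rcases h n with h | h
    · rw [hj, h]
    · rw [hj, h, mul_zero, mul_zero]

theorem IsEigenfunction.congr_coupling (hu : D.IsEigenfunction ω E u)
    (h : ∀ n, ω n = ω' n ∨ u (D.x n) = 0) : D.IsEigenfunction ω' E u :=
  ⟨⟨hu.sol.1.congr_coupling h, hu.sol.2⟩, hu.memLp, hu.left, hu.right, hu.exists_ne⟩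

end DeltaData

/-! ### Integration over one coordinate of an infinite product -/

/-- Resampling the coordinate `n` independently does not change a product measure. -/
theorem MeasureTheory.Measure.infinitePi_prod_map_update {ι : Type*} [DecidableEq ι]
    (p : ι → Measure ℝ) [∀ i, IsProbabilityMeasure (p i)] (n : ι) :
    ((infinitePi p).prod (p n)).map (fun q : (ι → ℝ) × ℝ => Function.update q.1 n q.2) =
      infinitePi p := by
  have hmeas : Measurable fun q : (ι → ℝ) × ℝ => Function.update q.1 n q.2 :=
    measurable_update'
  refine eq_infinitePi p fun s t ht => ?_
  rw [Measure.map_apply hmeas (MeasurableSet.pi s.countable_toSet fun i _ => ht i)]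
  by_cases hn : n ∈ s
  · have hpre : (fun q : (ι → ℝ) × ℝ => Function.update q.1 n q.2) ⁻¹' (s : Set ι).pi t =
        ((s.erase n : Finset ι) : Set ι).pi t ×ˢ t n := by
      ext q
      simp only [mem_preimage, Set.mem_pi, mem_prod, Finset.mem_coe, Finset.mem_erase]
      constructor
      · intro h
        refine ⟨fun i hi => ?_, by simpa using h n hn⟩
        simpa [Function.update_of_ne hi.1] using h i hi.2
      · rintro ⟨h1, h2⟩ i hi
        by_cases h : i = n
        · subst h; simpa using h2
        · simpa [Function.update_of_ne h] using h1 i ⟨h, hi⟩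
    rw [hpre, Measure.prod_prod, infinitePi_pi p fun i _ => ht i, mul_comm,
      Finset.mul_prod_erase s (fun i => p i (t i)) hn]
  · have hpre : (fun q : (ι → ℝ) × ℝ => Function.update q.1 n q.2) ⁻¹' (s : Set ι).pi t =
        (s : Set ι).pi t ×ˢ univ := by
      ext q
      simp only [mem_preimage, Set.mem_pi, mem_prod, mem_univ, and_true, Finset.mem_coe]
      refine forall₂_congr fun i hi => ?_
      rw [Function.update_of_ne (by rintro rfl; exact hn hi)]
    rw [hpre, Measure.prod_prod, infinitePi_pi p fun i _ => ht i, measure_univ, mul_one]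

/-- For almost every point `ω` of a measurable set the section of the set through `ω` in the
direction of the coordinate `n` is not a null set. -/
theorem MeasureTheory.Measure.ae_infinitePi_section_ne_zero {ι : Type*} [DecidableEq ι]
    (p : ι → Measure ℝ) [∀ i, IsProbabilityMeasure (p i)] (n : ι) {S : Set (ι → ℝ)}
    (hS : MeasurableSet S) :
    ∀ᵐ ω ∂infinitePi p, ω ∈ S → p n {t | Function.update ω n t ∈ S} ≠ 0 := by
  have hmeas : Measurable fun q : (ι → ℝ) × ℝ => Function.update q.1 n q.2 :=
    measurable_update'
  have hf : Measurable fun ω : ι → ℝ => p n {t | Function.update ω n t ∈ S} :=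
    measurable_measure_prodMk_left (hmeas hS)
  have hB : MeasurableSet {ω | ω ∈ S ∧ p n {t | Function.update ω n t ∈ S} = 0} :=
    hS.inter (hf (measurableSet_singleton 0))
  have h0 : infinitePi p {ω | ω ∈ S ∧ p n {t | Function.update ω n t ∈ S} = 0} = 0 := by
    rw [← infinitePi_prod_map_update p n, Measure.map_apply hmeas hB,
      Measure.measure_prod_null (hmeas hB)]
    refine Eventually.of_forall fun ω => ?_
    by_cases h : p n {t | Function.update ω n t ∈ S} = 0
    · refine measure_mono_null (fun t ht => ?_) h
      exact ht.1
    · refine (measure_mono_null (fun t ht => ?_) measure_empty : p n _ = 0)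
      have h2 := ht.2
      simp only [Function.update_idem] at h2
      exact h h2
  filter_upwards [measure_eq_zero_iff_ae_notMem.1 h0] with ω hω h1 h2 using hω ⟨h1, h2⟩

namespace DeltaData

variable {D : DeltaData} {E : ℝ}

/-- If `A(E)` is measurable and not a null set, there is an eigenfunction which vanishes at all
interaction points: for almost all `ω ∈ A(E)` and all `n`, the number `E` remains an eigenvalue
for a non-null set of values of the coupling at `xₙ`, in particular for more than one value. -/
theorem exists_eigenfunction_eq_zero_of_measure_ne_zero (hD : D.LimitPointOrRegular)
    (p : D.I → Measure ℝ) [∀ n, IsProbabilityMeasure (p n)] (hcont : ∀ n r, p n {r} = 0)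
    (hA : NullMeasurableSet (D.A E) (Measure.infinitePi p))
    (h0 : Measure.infinitePi p (D.A E) ≠ 0) :
    ∃ ω u, D.IsEigenfunction ω E u ∧ ∀ n, u (D.x n) = 0 := by
  classical
  obtain ⟨S, hSA, hS, hae⟩ := hA.exists_measurable_subset_ae_eq
  have hev : ∀ᵐ ω ∂Measure.infinitePi p, ∀ n, ω ∈ S →
      p n {t | Function.update ω n t ∈ S} ≠ 0 :=
    ae_all_iff.2 fun n => Measure.ae_infinitePi_section_ne_zero p n hS
  have hfreq : ∃ᵐ ω ∂Measure.infinitePi p, ω ∈ S := by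
    rw [frequently_ae_mem_iff, measure_congr hae]
    exact h0
  obtain ⟨ω, hω, h⟩ := (hfreq.and_eventually hev).exists
  obtain ⟨u, hu⟩ := mem_A_iff.1 (hSA hω)
  refine ⟨ω, u, hu, fun n => ?_⟩
  obtain ⟨t, ht, htn⟩ : ∃ t, Function.update ω n t ∈ S ∧ t ≠ ω n := by
    by_contra! hc
    exact h n hω (measure_mono_null (fun t ht => mem_singleton_iff.2 (hc t ht)) (hcont n (ω n)))
  obtain ⟨v, hv⟩ := mem_A_iff.1 (hSA ht)
  have hup : ∀ m, m ≠ n → ω m = Function.update ω n t m := fun m hm =>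
    (Function.update_of_ne hm _ _).symm
  rcases hu.eq_zero_or_eq_zero hD hv hup (by simpa using htn.symm) with h1 | h1
  · exact h1
  · have hv' : D.IsEigenfunction ω E v := hv.congr_coupling fun m => by
      by_cases hm : m = n
      · exact Or.inr (hm ▸ h1)
      · exact Or.inl (hup m hm).symm
    exact hv'.eq_zero_of_eq_zero hD hu (x_mem_J n) h1

end DeltaData

/-! ### Eigenvalues and the resolution of identity -/

namespace SpectralFamily

variable {H : Type*} [NormedAddCommGroup H] [InnerProductSpace ℂ H] (F : SpectralFamily H)

theorem proj_proj_of_le {s t : ℝ} (hst : s ≤ t) (ψ : H) : F.proj t (F.proj s ψ) = F.proj s ψ := by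
  refine ext_inner_right ℂ fun χ => ?_
  rw [F.symmetric, F.symmetric, F.increasing s t hst, F.symmetric]

theorem inner_proj_proj (t : ℝ) (φ ψ : H) :
    inner ℂ (F.proj t φ) (F.proj t ψ) = inner ℂ (F.proj t φ) ψ := by
  rw [← F.symmetric, F.idempotent]

theorem inner_proj_self (t : ℝ) (ψ : H) :
    inner ℂ ψ (F.proj t ψ) = ((‖F.proj t ψ‖ ^ 2 : ℝ) : ℂ) := by
  rw [← F.symmetric, ← F.inner_proj_proj, inner_self_eq_norm_sq_to_K]
  simp

theorem norm_proj_sub_sq {s t : ℝ} (hst : s ≤ t) (ψ : H) :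
    ‖F.proj t ψ - F.proj s ψ‖ ^ 2 = ‖F.proj t ψ‖ ^ 2 - ‖F.proj s ψ‖ ^ 2 := by
  have h : inner ℂ (F.proj t ψ) (F.proj s ψ) = ((‖F.proj s ψ‖ ^ 2 : ℝ) : ℂ) := by
    rw [F.symmetric, F.proj_proj_of_le hst, F.inner_proj_self]
  rw [_root_.norm_sub_sq (𝕜 := ℂ), h]
  simp only [RCLike.re_to_complex, Complex.ofReal_re]
  ring

theorem tendsto_stieltjes_atBot (ψ : H) : Tendsto (F.stieltjes ψ) atBot (𝓝 0) := by
  have h : Tendsto (fun t => ‖F.proj t ψ‖ ^ 2) atBot (𝓝 (‖(0 : H)‖ ^ 2)) :=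
    (F.tendsto_atBot ψ).norm.pow 2
  rwa [norm_zero, zero_pow two_ne_zero] at h

theorem tendsto_stieltjes_atTop (ψ : H) : Tendsto (F.stieltjes ψ) atTop (𝓝 (‖ψ‖ ^ 2)) :=
  (F.tendsto_atTop ψ).norm.pow 2

theorem measure_univ (ψ : H) : F.measure ψ univ = ENNReal.ofReal (‖ψ‖ ^ 2) := by
  rw [measure, StieltjesFunction.measure_univ _ (F.tendsto_stieltjes_atBot ψ)
    (F.tendsto_stieltjes_atTop ψ), sub_zero]

instance isFiniteMeasure_measure (ψ : H) : IsFiniteMeasure (F.measure ψ) :=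
  ⟨by rw [F.measure_univ]; exact ENNReal.ofReal_lt_top⟩

theorem measureReal_univ (ψ : H) : (F.measure ψ).real univ = ‖ψ‖ ^ 2 := by
  rw [Measure.real, F.measure_univ, ENNReal.toReal_ofReal (by positivity)]

theorem ae_le_of_proj_eq {s : ℝ} {ψ : H} (h : F.proj s ψ = ψ) : ∀ᵐ t ∂F.measure ψ, t ≤ s := by
  have h1 : F.measure ψ (Ioi s) = 0 := by
    rw [measure, StieltjesFunction.measure_Ioi _ (F.tendsto_stieltjes_atTop ψ)]
    change ENNReal.ofReal (‖ψ‖ ^ 2 - ‖F.proj s ψ‖ ^ 2) = 0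
    rw [h, sub_self, ENNReal.ofReal_zero]
  filter_upwards [measure_eq_zero_iff_ae_notMem.1 h1] with t ht using not_lt.1 ht

theorem ae_lt_of_proj_eq_zero {s : ℝ} {ψ : H} (h : F.proj s ψ = 0) :
    ∀ᵐ t ∂F.measure ψ, s < t := by
  have h1 : F.measure ψ (Iic s) = 0 := by
    rw [measure, StieltjesFunction.measure_Iic _ (F.tendsto_stieltjes_atBot ψ)]
    change ENNReal.ofReal (‖F.proj s ψ‖ ^ 2 - 0) = 0
    simp [h]
  filter_upwards [measure_eq_zero_iff_ae_notMem.1 h1] with t ht using not_le.1 ht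

theorem measure_add_smul {φ ψ : H} (h : ∀ t, inner ℂ (F.proj t φ) (F.proj t ψ) = 0) (c : ℂ) :
    F.measure (φ + c • ψ) = F.measure φ + (‖c‖₊ ^ 2) • F.measure ψ := by
  have h1 : F.stieltjes (φ + c • ψ) = F.stieltjes φ + (‖c‖₊ ^ 2) • F.stieltjes ψ := by
    ext t
    change ‖F.proj t (φ + c • ψ)‖ ^ 2 = ‖F.proj t φ‖ ^ 2 + ‖c‖ ^ 2 * ‖F.proj t ψ‖ ^ 2
    rw [map_add, map_smul, norm_add_sq (𝕜 := ℂ), inner_smul_right, h, norm_smul]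
    simp only [mul_zero, map_zero, add_zero]
    ring
  rw [measure, h1, StieltjesFunction.measure_add, StieltjesFunction.measure_smul]
  rfl

theorem inner_proj_proj_sub (s t : ℝ) (φ ψ : H) :
    inner ℂ (F.proj t (F.proj s φ)) (F.proj t (ψ - F.proj s ψ)) = 0 := by
  rw [F.inner_proj_proj]
  rcases le_total s t with h | h
  · rw [F.proj_proj_of_le h, F.symmetric, map_sub, F.idempotent, sub_self, inner_zero_right]
  · rw [F.increasing t s h, F.symmetric, map_sub, F.increasing t s h, sub_self, inner_zero_right]

/-- The projections `E(s)` reduce the spectral measures. -/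
theorem measure_eq_add (s : ℝ) (ψ : H) :
    F.measure ψ = F.measure (F.proj s ψ) + F.measure (ψ - F.proj s ψ) := by
  have h := F.measure_add_smul (φ := F.proj s ψ) (ψ := ψ - F.proj s ψ)
    (fun t => F.inner_proj_proj_sub s t ψ ψ) 1
  simpa using h

namespace IsResolutionOf

variable {F} {S : H →ₗ.[ℂ] H} {E : ℝ}

theorem integrable_id (hF : F.IsResolutionOf S) (ψ : S.domain) :
    Integrable (fun t : ℝ => t) (F.measure (ψ : H)) := by
  have h := (hF.mem_domain_iff ψ).1 ψ.2
  refine (h.add (integrable_const (1 : ℝ))).mono' aestronglyMeasurable_id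
    (Eventually.of_forall fun t => ?_)
  simp only [Real.norm_eq_abs, Pi.add_apply]
  nlinarith [sq_nonneg (|t| - 1), sq_abs t, abs_nonneg t]

/-- Vectors which are orthogonal under all `E(t)` are orthogonal for the form of `S`. -/
theorem inner_apply_eq_zero (hF : F.IsResolutionOf S) (φ ψ : S.domain)
    (h : ∀ t, inner ℂ (F.proj t (φ : H)) (F.proj t (ψ : H)) = 0) :
    inner ℂ (φ : H) (S ψ) = 0 := by
  -- The spectral measure of `φ + c ψ` is the sum of those of `φ` and `c ψ`, so the mixed terms of
  -- the form cancel for all `c`; taking `c = 1` and `c = i` separates them.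
  have key : ∀ c : ℂ,
      c * inner ℂ (φ : H) (S ψ) + (starRingEnd ℂ) c * inner ℂ (ψ : H) (S φ) = 0 := by
    intro c
    have h1 := hF.inner_apply (φ + c • ψ)
    have hm : F.measure ((φ + c • ψ : S.domain) : H) =
        F.measure (φ : H) + (‖c‖₊ ^ 2) • F.measure (ψ : H) := F.measure_add_smul h c
    rw [hm, integral_add_measure (hF.integrable_id φ)
      ((hF.integrable_id ψ).smul_measure_nnreal), integral_smul_nnreal_measure,
      LinearPMap.map_add, LinearPMap.map_smul] at h1
    have h2 : ((∫ t, t ∂F.measure (φ : H) : ℝ) : ℂ) = inner ℂ (φ : H) (S φ) :=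
      (hF.inner_apply φ).symm
    have h3 : ((∫ t, t ∂F.measure (ψ : H) : ℝ) : ℂ) = inner ℂ (ψ : H) (S ψ) :=
      (hF.inner_apply ψ).symm
    have h4 : (((‖c‖₊ ^ 2 : NNReal) • ∫ t, t ∂F.measure (ψ : H) : ℝ) : ℂ) =
        (starRingEnd ℂ) c * c * inner ℂ (ψ : H) (S ψ) := by
      rw [← h3, ← Complex.normSq_eq_conj_mul_self, Complex.normSq_eq_norm_sq]
      simp [NNReal.smul_def]
    rw [Complex.ofReal_add, h4, h2] at h1
    simp only [Submodule.coe_add, Submodule.coe_smul, inner_add_left, inner_add_right,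
      inner_smul_left, inner_smul_right] at h1
    linear_combination h1
  have k1 := key 1
  have k2 := key Complex.I
  simp only [one_mul, map_one, Complex.conj_I] at k1 k2
  have h5 : 2 * Complex.I * inner ℂ (φ : H) (S ψ) = 0 := by
    linear_combination Complex.I * k1 + k2
  simpa using h5

theorem proj_mem_domain (hF : F.IsResolutionOf S) (s : ℝ) {ψ : H} (hψ : ψ ∈ S.domain) :
    F.proj s ψ ∈ S.domain := by
  rw [hF.mem_domain_iff] at hψ ⊢
  rw [F.measure_eq_add s ψ] at hψ
  exact hψ.left_of_add_measure

/-- An eigenvector of `S` belongs to the jump of the resolution of identity at the eigenvalue. -/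
theorem proj_eq_of_apply_eq (hF : F.IsResolutionOf S) {ψ : S.domain}
    (hψ : S ψ = (E : ℂ) • (ψ : H)) :
    F.proj E (ψ : H) = ψ ∧ ∀ s < E, F.proj s (ψ : H) = 0 := by
  -- Both parts of the decomposition of `ψ` by `E(s)` have the mean value `E` under their spectral
  -- measures, which live on `(-∞, s]` and `(s, ∞)`.
  have hdec : ∀ s, ∃ ψ₁ ψ₂ : S.domain, (ψ₁ : H) = F.proj s ψ ∧ (ψ₂ : H) = ψ - F.proj s ψ ∧
      (∫ t, t ∂F.measure (ψ₁ : H)) = E * ‖(ψ₁ : H)‖ ^ 2 ∧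
      (∫ t, t ∂F.measure (ψ₂ : H)) = E * ‖(ψ₂ : H)‖ ^ 2 := by
    intro s
    set ψ₁ : S.domain := ⟨F.proj s ψ, hF.proj_mem_domain s ψ.2⟩ with e1
    have ho := F.inner_proj_proj_sub s
    have hadd : ψ = ψ₁ + (ψ - ψ₁) := by abel
    have hS : S ψ = S ψ₁ + S (ψ - ψ₁) := by rw [← LinearPMap.map_add, ← hadd]
    have horth : inner ℂ (ψ₁ : H) ((ψ - ψ₁ : S.domain) : H) = 0 := by
      change inner ℂ (F.proj s (ψ : H)) ((ψ : H) - F.proj s ψ) = 0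
      rw [F.symmetric, map_sub, F.idempotent, sub_self, inner_zero_right]
    have hcoe : (ψ : H) = (ψ₁ : H) + ((ψ - ψ₁ : S.domain) : H) := by
      rw [← Submodule.coe_add, ← hadd]
    refine ⟨ψ₁, ψ - ψ₁, rfl, rfl, ?_, ?_⟩
    · have h1 := hF.inner_apply_eq_zero ψ₁ (ψ - ψ₁) fun t => ho t ψ ψ
      have h2 := hF.inner_apply ψ₁
      have h3 : inner ℂ (ψ₁ : H) (S ψ₁) = inner ℂ (ψ₁ : H) (S ψ) := by
        rw [hS, inner_add_right, h1, add_zero]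
      rw [h3, hψ, inner_smul_right, hcoe, inner_add_right, horth, add_zero,
        inner_self_eq_norm_sq_to_K] at h2
      refine Complex.ofReal_injective (h2.symm.trans ?_)
      simp
    · have h1 := hF.inner_apply_eq_zero (ψ - ψ₁) ψ₁ fun t =>
        inner_eq_zero_symm.1 (ho t ψ ψ)
      have h2 := hF.inner_apply (ψ - ψ₁)
      have h3 : inner ℂ ((ψ - ψ₁ : S.domain) : H) (S (ψ - ψ₁)) =
          inner ℂ ((ψ - ψ₁ : S.domain) : H) (S ψ) := by
        rw [hS, inner_add_right, h1, zero_add]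
      rw [h3, hψ, inner_smul_right, hcoe, inner_add_right, inner_eq_zero_symm.1 horth, zero_add,
        inner_self_eq_norm_sq_to_K] at h2
      refine Complex.ofReal_injective (h2.symm.trans ?_)
      simp
  have hlow : ∀ s < E, F.proj s (ψ : H) = 0 := by
    intro s hs
    obtain ⟨ψ₁, ψ₂, h1, -, h2, -⟩ := hdec s
    have h3 : (∫ t, t ∂F.measure (ψ₁ : H)) ≤ ∫ _, s ∂F.measure (ψ₁ : H) :=
      integral_mono_ae (hF.integrable_id ψ₁) (integrable_const _)
        (F.ae_le_of_proj_eq (by rw [h1, F.idempotent]))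
    rw [integral_const, F.measureReal_univ, h2, smul_eq_mul] at h3
    rw [← h1]
    by_contra hne
    nlinarith [mul_pos (sub_pos.2 hs) (pow_pos (norm_pos_iff.2 hne) 2)]
  have hhigh : ∀ s, E < s → F.proj s (ψ : H) = ψ := by
    intro s hs
    obtain ⟨ψ₁, ψ₂, -, h1, -, h2⟩ := hdec s
    have h3 : (∫ _, s ∂F.measure (ψ₂ : H)) ≤ ∫ t, t ∂F.measure (ψ₂ : H) :=
      integral_mono_ae (integrable_const _) (hF.integrable_id ψ₂)
        ((F.ae_lt_of_proj_eq_zero (by rw [h1, map_sub, F.idempotent, sub_self])).mono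
          fun t ht => le_of_lt ht)
    rw [integral_const, F.measureReal_univ, h2, smul_eq_mul] at h3
    have h4 : (ψ₂ : H) = 0 := by
      by_contra hne
      nlinarith [mul_pos (sub_pos.2 hs) (pow_pos (norm_pos_iff.2 hne) 2)]
    rw [h1, sub_eq_zero] at h4
    exact h4.symm
  refine ⟨tendsto_nhds_unique (F.right_continuous E ψ) (tendsto_const_nhds.congr' ?_), hlow⟩
  filter_upwards [self_mem_nhdsWithin] with s hs using (hhigh s hs).symm

theorem sub_mem_domain (hF : F.IsResolutionOf S) {N : ℝ} (hN : 0 ≤ N) (η : H) :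
    F.proj N η - F.proj (-N) η ∈ S.domain := by
  rw [hF.mem_domain_iff]
  have h1 := F.ae_le_of_proj_eq (s := N) (ψ := F.proj N η - F.proj (-N) η) (by
    rw [map_sub, F.idempotent, F.proj_proj_of_le (by linarith)])
  have h2 := F.ae_lt_of_proj_eq_zero (s := -N) (ψ := F.proj N η - F.proj (-N) η) (by
    rw [map_sub, F.idempotent, F.increasing _ _ (by linarith), sub_self])
  refine (integrable_const (N ^ 2)).mono' (by fun_prop) ?_
  filter_upwards [h1, h2] with t ht1 ht2
  rw [Real.norm_eq_abs, abs_of_nonneg (sq_nonneg t)]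
  nlinarith

/-- A vector in the jump of the resolution of identity at `E` is an eigenvector of `S`. -/
theorem apply_eq_of_proj_eq (hF : F.IsResolutionOf S) {φ : H} (h1 : F.proj E φ = φ)
    (h2 : ∀ s < E, F.proj s φ = 0) : ∃ ψ : S.domain, (ψ : H) = φ ∧ S ψ = (E : ℂ) • (ψ : H) := by
  have hae : ∀ᵐ t ∂F.measure φ, t = E := by
    have h3 : ∀ᵐ t ∂F.measure φ, ∀ n : ℕ, E - 1 / ((n : ℝ) + 1) < t :=
      ae_all_iff.2 fun n => F.ae_lt_of_proj_eq_zero (h2 _ (by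
        have : (0 : ℝ) < 1 / ((n : ℝ) + 1) := by positivity
        linarith))
    filter_upwards [h3, F.ae_le_of_proj_eq h1] with t ht1 ht2
    refine le_antisymm ht2 (le_of_tendsto' (f := fun n : ℕ => E - 1 / ((n : ℝ) + 1)) (x := atTop)
      ?_ fun n => (ht1 n).le)
    simpa using (tendsto_const_nhds (x := E)).sub
      (tendsto_one_div_add_atTop_nhds_zero_nat (𝕜 := ℝ))
  have hdom : φ ∈ S.domain := by
    rw [hF.mem_domain_iff]
    refine (integrable_const (E ^ 2)).congr (hae.mono fun t ht => ?_)
    simp only [ht]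
  have hform : inner ℂ φ (S ⟨φ, hdom⟩) = (E : ℂ) * inner ℂ φ φ := by
    have h3 := hF.inner_apply ⟨φ, hdom⟩
    have h4 : (∫ t, t ∂F.measure φ) = E * ‖φ‖ ^ 2 := by
      rw [integral_congr_ae (g := fun _ => E) hae, integral_const, F.measureReal_univ, smul_eq_mul,
        mul_comm]
    simp only [h4] at h3
    rw [h3, inner_self_eq_norm_sq_to_K]
    simp
  refine ⟨⟨φ, hdom⟩, rfl, ?_⟩
  by_cases hφ : inner ℂ φ φ = 0
  · have h0 : φ = 0 := inner_self_eq_zero.1 hφ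
    subst h0
    have : (⟨0, hdom⟩ : S.domain) = 0 := rfl
    rw [this, LinearPMap.map_zero]
    simp
  -- Vectors of the domain are a multiple of `φ` plus a vector orthogonal to `φ`.
  have hall : ∀ χ : S.domain, inner ℂ (χ : H) (S ⟨φ, hdom⟩ - (E : ℂ) • φ) = 0 := by
    intro χ
    set c : ℂ := inner ℂ φ (χ : H) / inner ℂ φ φ with hc
    have ho : inner ℂ φ ((χ : H) - c • φ) = 0 := by
      rw [inner_sub_right, inner_smul_right, hc, div_mul_cancel₀ _ hφ, sub_self]
    have h3 := hF.inner_apply_eq_zero (χ - c • ⟨φ, hdom⟩) ⟨φ, hdom⟩ fun t => by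
      change inner ℂ (F.proj t ((χ : H) - c • φ)) (F.proj t φ) = 0
      rw [← F.symmetric, F.idempotent, F.symmetric]
      rcases lt_or_ge t E with h | h
      · rw [h2 t h, inner_zero_right]
      · rw [show F.proj t φ = φ by rw [← h1, F.proj_proj_of_le h]]
        exact inner_eq_zero_symm.1 ho
    have h4 : inner ℂ ((χ : H) - c • φ) (S ⟨φ, hdom⟩) = 0 := h3
    have h5 := inner_eq_zero_symm.1 ho
    rw [inner_sub_left, inner_smul_left] at h4 h5
    rw [inner_sub_right, inner_smul_right]
    linear_combination h4 + (starRingEnd ℂ) c * hform - E * h5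
  -- The domain is dense, since it contains all `(E(N) - E(-N)) y`.
  set y := S ⟨φ, hdom⟩ - (E : ℂ) • φ with hy
  have hlim : Tendsto (fun N : ℝ => inner ℂ (F.proj N y - F.proj (-N) y) y) atTop
      (𝓝 (inner ℂ (y - 0) y)) :=
    ((F.tendsto_atTop y).sub ((F.tendsto_atBot y).comp tendsto_neg_atTop_atBot)).inner
      tendsto_const_nhds
  have h0 : inner ℂ (y - 0) y = 0 := tendsto_nhds_unique hlim
    (tendsto_const_nhds.congr' ((eventually_ge_atTop 0).mono fun N hN =>
      (hall ⟨_, hF.sub_mem_domain hN y⟩).symm))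
  rw [sub_zero, inner_self_eq_zero] at h0
  exact sub_eq_zero.1 h0

theorem isRealEigenvalue_iff (hF : F.IsResolutionOf S) :
    IsRealEigenvalue S E ↔ ∃ φ : H, φ ≠ 0 ∧ F.proj E φ = φ ∧ ∀ s < E, F.proj s φ = 0 := by
  constructor
  · rintro ⟨ψ, h0, h⟩
    exact ⟨ψ, h0, hF.proj_eq_of_apply_eq h⟩
  · rintro ⟨φ, h0, h1, h2⟩
    obtain ⟨ψ, rfl, h⟩ := hF.apply_eq_of_proj_eq h1 h2
    exact ⟨ψ, h0, h⟩

end IsResolutionOf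

/-- The strong left limit of a spectral family exists. -/
theorem exists_tendsto_left [CompleteSpace H] (E : ℝ) (η : H) :
    ∃ x, Tendsto (fun k : ℕ => F.proj (E - 1 / ((k : ℝ) + 1)) η) atTop (𝓝 x) := by
  have hmono : Monotone fun k : ℕ => E - 1 / ((k : ℝ) + 1) := fun k m hkm =>
    sub_le_sub_left (one_div_le_one_div_of_le (by positivity)
      (by have : (k : ℝ) ≤ m := by exact_mod_cast hkm
          linarith)) _
  have hconv : ∃ a, Tendsto (fun k : ℕ => ‖F.proj (E - 1 / ((k : ℝ) + 1)) η‖ ^ 2) atTop (𝓝 a) := by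
    refine ⟨_, tendsto_atTop_ciSup (fun k m hkm => (F.stieltjes η).mono (hmono hkm)) ⟨‖η‖ ^ 2, ?_⟩⟩
    rintro _ ⟨k, rfl⟩
    exact pow_le_pow_left₀ (norm_nonneg _) (F.norm_proj_le _ _) 2
  obtain ⟨a, ha⟩ := hconv
  -- The squared distance of two terms is the difference of their squared norms.
  refine cauchySeq_tendsto_of_complete (Metric.cauchySeq_iff'.2 fun ε hε => ?_)
  obtain ⟨N, hN⟩ := Metric.cauchySeq_iff'.1 ha.cauchySeq (ε ^ 2) (by positivity)
  refine ⟨N, fun n hn => ?_⟩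
  have h1 := hN n hn
  rw [Real.dist_eq, ← F.norm_proj_sub_sq (hmono hn), abs_of_nonneg (by positivity)] at h1
  rw [dist_eq_norm]
  exact lt_of_pow_lt_pow_left₀ 2 hε.le h1

/-- The resolution of identity jumps at `E` if and only if it jumps on a vector of a given dense
set. -/
theorem exists_jump_iff [CompleteSpace H] (E : ℝ) {ι : Type*} {e : ι → H} (he : DenseRange e) :
    (∃ φ : H, φ ≠ 0 ∧ F.proj E φ = φ ∧ ∀ s < E, F.proj s φ = 0) ↔
      ∃ (i : ι) (m : ℕ), ∀ k : ℕ, 1 / ((m : ℝ) + 1) ≤ (inner ℂ (e i) (F.proj E (e i)) : ℂ).re -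
        (inner ℂ (e i) (F.proj (E - 1 / ((k : ℝ) + 1)) (e i)) : ℂ).re := by
  have hlt : ∀ k : ℕ, E - 1 / ((k : ℝ) + 1) < E := fun k => by
    have : (0 : ℝ) < 1 / ((k : ℝ) + 1) := by positivity
    linarith
  have hnorm : ∀ i, ∀ k : ℕ, (inner ℂ (e i) (F.proj E (e i)) : ℂ).re -
      (inner ℂ (e i) (F.proj (E - 1 / ((k : ℝ) + 1)) (e i)) : ℂ).re =
      ‖F.proj E (e i) - F.proj (E - 1 / ((k : ℝ) + 1)) (e i)‖ ^ 2 := fun i k => by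
    rw [F.norm_proj_sub_sq (hlt k).le, F.inner_proj_self, F.inner_proj_self, Complex.ofReal_re,
      Complex.ofReal_re]
  simp only [hnorm]
  constructor
  · rintro ⟨φ, h0, h1, h2⟩
    have hpos : 0 < ‖φ‖ := norm_pos_iff.2 h0
    obtain ⟨i, hi⟩ := he.exists_dist_lt φ (ε := ‖φ‖ / 4) (by positivity)
    obtain ⟨m, hm⟩ := exists_nat_one_div_lt (show 0 < (‖φ‖ / 2) ^ 2 by positivity)
    refine ⟨i, m, fun k => hm.le.trans (pow_le_pow_left₀ (by positivity) ?_ 2)⟩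
    set s := E - 1 / ((k : ℝ) + 1) with hs
    have h3 : F.proj E (e i) - F.proj s (e i) =
        φ + (F.proj E (e i - φ) - F.proj s (e i - φ)) := by
      rw [map_sub, map_sub, h1, h2 s (hlt k)]
      abel
    have h4 : ‖F.proj E (e i - φ) - F.proj s (e i - φ)‖ ≤ ‖φ‖ / 4 + ‖φ‖ / 4 := by
      have h5 : ‖e i - φ‖ ≤ ‖φ‖ / 4 := by
        rw [← dist_eq_norm, dist_comm]; exact hi.le
      exact (norm_sub_le _ _).trans (add_le_add ((F.norm_proj_le _ _).trans h5)
        ((F.norm_proj_le _ _).trans h5))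
    rw [h3]
    have h6 := norm_le_add_norm_add φ (F.proj E (e i - φ) - F.proj s (e i - φ))
    linarith
  · rintro ⟨i, m, h⟩
    obtain ⟨x, hx⟩ := F.exists_tendsto_left E (e i)
    have hx' : Tendsto (fun k : ℕ => F.proj E (e i) - F.proj (E - 1 / ((k : ℝ) + 1)) (e i)) atTop
        (𝓝 (F.proj E (e i) - x)) := tendsto_const_nhds.sub hx
    refine ⟨F.proj E (e i) - x, fun h0 => ?_, ?_, fun s hs => ?_⟩
    · have h1 := ge_of_tendsto' (hx'.norm.pow 2) h
      rw [h0] at h1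
      have : (0 : ℝ) < 1 / ((m : ℝ) + 1) := by positivity
      simp only [norm_zero] at h1
      linarith
    · refine tendsto_nhds_unique (((F.proj E).continuous.tendsto _).comp hx')
        (hx'.congr fun k => ?_)
      simp only [Function.comp]
      rw [map_sub, F.idempotent, F.proj_proj_of_le (hlt k).le]
    · refine tendsto_nhds_unique (((F.proj s).continuous.tendsto _).comp hx')
        (tendsto_const_nhds.congr' ?_)
      have hev : ∀ᶠ k : ℕ in atTop, s < E - 1 / ((k : ℝ) + 1) := by
        have hl : Tendsto (fun k : ℕ => E - 1 / ((k : ℝ) + 1)) atTop (𝓝 (E - 0)) :=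
          tendsto_const_nhds.sub (tendsto_one_div_add_atTop_nhds_zero_nat (𝕜 := ℝ))
        exact hl.eventually (lt_mem_nhds (by simpa using hs))
      filter_upwards [hev] with k hk
      simp only [Function.comp]
      rw [map_sub, F.increasing _ _ hs.le, F.increasing _ _ hk.le, sub_self]

end SpectralFamily

/-- For a measurable family of selfadjoint operators in a separable Hilbert space the set of
parameters for which a given number is an eigenvalue is measurable. -/
theorem MeasurableFamily.measurableSet_isRealEigenvalue {H : Type*} [NormedAddCommGroup H]
    [InnerProductSpace ℂ H] [CompleteSpace H] [TopologicalSpace.SeparableSpace H] {Ω : Type*}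
    [MeasurableSpace Ω] {S : Ω → H →ₗ.[ℂ] H} (h : MeasurableFamily S) (E : ℝ) :
    MeasurableSet {ω | IsRealEigenvalue (S ω) E} := by
  obtain ⟨F, hF, hm⟩ := h
  set e := TopologicalSpace.denseSeq H with he
  have heq : {ω | IsRealEigenvalue (S ω) E} = ⋃ (i : ℕ) (m : ℕ), ⋂ k : ℕ,
      {ω | 1 / ((m : ℝ) + 1) ≤
        (inner ℂ (e i) ((F ω).proj E (e i)) : ℂ).re -
        (inner ℂ (e i) ((F ω).proj (E - 1 / ((k : ℝ) + 1)) (e i)) : ℂ).re} := by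
    ext ω
    simp only [mem_ofPred_eq, mem_iUnion, mem_iInter]
    rw [(hF ω).isRealEigenvalue_iff,
      (F ω).exists_jump_iff E (TopologicalSpace.denseRange_denseSeq H)]
  rw [heq]
  refine MeasurableSet.iUnion fun i => MeasurableSet.iUnion fun m =>
    MeasurableSet.iInter fun k => ?_
  exact measurableSet_le measurable_const
    ((Complex.measurable_re.comp (hm _ _ _)).sub (Complex.measurable_re.comp (hm _ _ _)))

namespace DeltaData

variable {D : DeltaData} {E : ℝ}

theorem measure_A_eq_zero_or_eq_univ (hD : D.LimitPointOrRegular) (p : D.I → Measure ℝ)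
    [∀ n, IsProbabilityMeasure (p n)] (hcont : ∀ n r, p n {r} = 0)
    (hm : MeasurableFamily (Ω := D.Omega p) (fun ω => D.operator ω)) :
    D.P p (D.A E) = 0 ∨ D.A E = univ := by
  have : Fact ((2 : ENNReal) ≠ ⊤) := ⟨by norm_num⟩
  have hA : NullMeasurableSet (D.A E) (Measure.infinitePi p) :=
    hm.measurableSet_isRealEigenvalue E
  rw [Measure.completion_apply]
  refine or_iff_not_imp_left.2 fun h0 => ?_
  obtain ⟨ω, u, hu, hz⟩ := exists_eigenfunction_eq_zero_of_measure_ne_zero hD p hcont hA h0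
  exact eq_univ_of_forall fun ω' => mem_A_iff.2 ⟨u, hu.congr_coupling fun n => Or.inr (hz n)⟩

end DeltaData

/-! ### The free equation `-u'' = E u` -/

/-- `C` and `S` are the solutions of `-u'' = E u` with Cauchy data `(1, 0)` and `(0, 1)` at `0`,
together with the consequences of their addition theorems which are needed. -/
structure IsFundamentalPair (E : ℝ) (C S : ℝ → ℝ) : Prop where
  hasDerivAt_C : ∀ t, HasDerivAt C (-E * S t) t
  hasDerivAt_S : ∀ t, HasDerivAt S (C t) t
  C_zero : C 0 = 1
  S_zero : S 0 = 0
  C_add_C_sub : ∀ t h, C (t + h) + C (t - h) = 2 * C h * C t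
  S_add_S_sub : ∀ t h, S (t + h) + S (t - h) = 2 * C h * S t
  exists_one_le : ∃ h₀, ∀ h, 1 ≤ C h ^ 2 + C (h + h₀) ^ 2

theorem exists_isFundamentalPair (E : ℝ) : ∃ C S, IsFundamentalPair E C S := by
  rcases lt_trichotomy E 0 with hE | rfl | hE
  · obtain ⟨k, hk, rfl⟩ : ∃ k : ℝ, 0 < k ∧ E = -k ^ 2 :=
      ⟨√(-E), Real.sqrt_pos.2 (by linarith), by rw [Real.sq_sqrt (by linarith)]; ring⟩
    refine ⟨fun t => Real.cosh (k * t), fun t => Real.sinh (k * t) / k, ?_, ?_, by simp, by simp,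
      ?_, ?_, 0, fun h => ?_⟩
    · intro t
      refine (((hasDerivAt_id t).const_mul k).cosh).congr_deriv ?_
      simp only [id]; field_simp
    · intro t
      refine ((((hasDerivAt_id t).const_mul k).sinh).div_const k).congr_deriv ?_
      simp only [id]; field_simp
    · intro t h
      simp only [mul_add, mul_sub, Real.cosh_add, Real.cosh_sub]
      ring
    · intro t h
      simp only [mul_add, mul_sub, Real.sinh_add, Real.sinh_sub]
      ring
    · have := Real.one_le_cosh (k * h)
      simp only [add_zero]
      nlinarith
  · refine ⟨fun _ => 1, fun t => t, ?_, ?_, rfl, rfl, ?_, ?_, 0, ?_⟩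
    · intro t; simpa using hasDerivAt_const t (1 : ℝ)
    · intro t; exact hasDerivAt_id t
    · intro t h; norm_num
    · intro t h; ring
    · intro h; norm_num
  · obtain ⟨k, hk, rfl⟩ : ∃ k : ℝ, 0 < k ∧ E = k ^ 2 :=
      ⟨√E, Real.sqrt_pos.2 hE, by rw [Real.sq_sqrt hE.le]⟩
    refine ⟨fun t => Real.cos (k * t), fun t => Real.sin (k * t) / k, ?_, ?_, by simp, by simp,
      ?_, ?_, Real.pi / 2 / k, fun h => ?_⟩
    · intro t
      refine (((hasDerivAt_id t).const_mul k).cos).congr_deriv ?_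
      simp only [id]; field_simp
    · intro t
      refine ((((hasDerivAt_id t).const_mul k).sin).div_const k).congr_deriv ?_
      simp only [id]; field_simp
    · intro t h
      simp only [mul_add, mul_sub, Real.cos_add, Real.cos_sub]
      ring
    · intro t h
      simp only [mul_add, mul_sub, Real.sin_add, Real.sin_sub]
      ring
    · have h1 : k * (h + Real.pi / 2 / k) = k * h + Real.pi / 2 := by field_simp
      simp only [h1, Real.cos_add_pi_div_two, neg_sq]
      exact (Real.cos_sq_add_sin_sq _).ge

/-- The free equation has no nonzero square integrable solution: the solution satisfies
`f (t + h) + f (t - h) = 2 C(h) f(t)`, and the factors `C(h)` are not small on average. -/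
theorem IsFundamentalPair.eq_zero_of_integrable {E : ℝ} {C S : ℝ → ℝ} (h : IsFundamentalPair E C S)
    (α β : ℂ) (c : ℝ) (hi : Integrable fun t => ‖α * C (t - c) + β * S (t - c)‖ ^ 2) (t : ℝ) :
    α * C (t - c) + β * S (t - c) = 0 := by
  set f : ℝ → ℂ := fun t => α * C (t - c) + β * S (t - c) with hf
  have hadd : ∀ r s, f (r + s) + f (r - s) = 2 * C s * f r := fun r s => by
    have h1 : ((C (r - c + s) : ℝ) : ℂ) + C (r - c - s) = 2 * C s * C (r - c) := by
      exact_mod_cast h.C_add_C_sub (r - c) s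
    have h2 : ((S (r - c + s) : ℝ) : ℂ) + S (r - c - s) = 2 * C s * S (r - c) := by
      exact_mod_cast h.S_add_S_sub (r - c) s
    simp only [hf]
    rw [show r + s - c = r - c + s by ring, show r - s - c = r - c - s by ring]
    linear_combination α * h1 + β * h2
  have hle : ∀ r s, 4 * C s ^ 2 * ‖f r‖ ^ 2 ≤ 2 * ‖f (r + s)‖ ^ 2 + 2 * ‖f (r - s)‖ ^ 2 := by
    intro r s
    have h1 : ‖2 * (C s : ℂ) * f r‖ ^ 2 = 4 * C s ^ 2 * ‖f r‖ ^ 2 := by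
      rw [norm_mul, norm_mul, Complex.norm_real, mul_pow, mul_pow, Real.norm_eq_abs, sq_abs]
      norm_num
    rw [← h1, ← hadd r s]
    have h2 := norm_add_le (f (r + s)) (f (r - s))
    nlinarith [sq_nonneg (‖f (r + s)‖ - ‖f (r - s)‖), norm_nonneg (f (r + s) + f (r - s))]
  obtain ⟨h₀, hh₀⟩ := h.exists_one_le
  have hi' : Integrable fun s => ‖f s‖ ^ 2 := hi
  have hG : Integrable fun s => (2 * ‖f (t + s)‖ ^ 2 + 2 * ‖f (t - s)‖ ^ 2) +
      (2 * ‖f (t + (s + h₀))‖ ^ 2 + 2 * ‖f (t - (s + h₀))‖ ^ 2) := by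
    have i1 : Integrable fun s => 2 * ‖f (t + s)‖ ^ 2 + 2 * ‖f (t - s)‖ ^ 2 :=
      ((hi'.comp_add_left t).const_mul 2).add ((hi'.comp_sub_left t).const_mul 2)
    exact i1.add (i1.comp_add_right h₀)
  have hc : Integrable fun _ : ℝ => 4 * ‖f t‖ ^ 2 := by
    refine hG.mono' aestronglyMeasurable_const (Eventually.of_forall fun s => ?_)
    rw [Real.norm_of_nonneg (by positivity)]
    nlinarith [hle t s, hle t (s + h₀), mul_le_mul_of_nonneg_right (hh₀ s) (sq_nonneg ‖f t‖)]
  -- A constant which is integrable over the line vanishes.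
  rw [integrable_const_iff] at hc
  rcases hc with hc | hc
  · simpa using hc
  · have := hc.measure_univ_lt_top
    simp at this

/-! ### Measurable dependence of square integrability on parameters -/

/-- If `f₁ + s f₂` is square integrable while `f₂` is not, then `s` is determined by `f₁`
and `f₂`: on `[-N, N]` the integral of `(f₁ + s f₂) f₂` is small compared to that of `f₂²`. -/
theorem tendsto_neg_integral_mul_div {f₁ f₂ : ℝ → ℝ} (h₁ : Continuous f₁) (h₂ : Continuous f₂)
    {s : ℝ} (hs : Integrable fun t => (f₁ t + s * f₂ t) ^ 2)
    (hn : ¬ Integrable fun t => f₂ t ^ 2) :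
    Tendsto (fun N : ℕ => -(∫ t in (-(N : ℝ))..N, f₁ t * f₂ t) / ∫ t in (-(N : ℝ))..N, f₂ t ^ 2)
      atTop (𝓝 s) := by
  set Q : ℕ → ℝ := fun N => ∫ t in (-(N : ℝ))..N, f₂ t ^ 2 with hQ
  have hle : ∀ N : ℕ, -(N : ℝ) ≤ N := fun N => by
    have : (0 : ℝ) ≤ N := Nat.cast_nonneg N
    linarith
  have hQmono : Monotone Q := fun N N' hNN => by
    have h0 : (N : ℝ) ≤ N' := by exact_mod_cast hNN
    exact intervalIntegral.integral_mono_interval (neg_le_neg h0) (hle N) h0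
      (Eventually.of_forall fun t => sq_nonneg _) ((h₂.pow 2).intervalIntegrable _ _)
  have hQtop : Tendsto Q atTop atTop := by
    refine tendsto_atTop_atTop_of_monotone hQmono fun B => ?_
    by_contra! hc
    refine hn (integrable_of_intervalIntegral_norm_bounded (l := atTop) B
      (a := fun N : ℕ => -(N : ℝ)) (b := fun N : ℕ => (N : ℝ))
      (fun N => (h₂.pow 2).integrableOn_Ioc)
      (tendsto_neg_atTop_atBot.comp tendsto_natCast_atTop_atTop) tendsto_natCast_atTop_atTop
      (Eventually.of_forall fun N => ?_))
    simp only [norm_pow, Real.norm_eq_abs, sq_abs]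
    exact (hc N).le
  set G : ℝ := ∫ t, (f₁ t + s * f₂ t) ^ 2 with hG
  -- `|g f₂| ≤ g² / (4 ε) + ε f₂²` with `g = f₁ + s f₂`.
  have hbound : ∀ ε > 0, ∀ N : ℕ,
      |(∫ t in (-(N : ℝ))..N, f₁ t * f₂ t) + s * Q N| ≤ G / (4 * ε) + ε * Q N := by
    intro ε hε N
    have i0 : Continuous fun t => f₁ t + s * f₂ t := h₁.add (continuous_const.mul h₂)
    have c1 : Continuous fun t => f₁ t * f₂ t := h₁.mul h₂
    have c2 : Continuous fun t => s * f₂ t ^ 2 := by fun_prop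
    have c3 : Continuous fun t => (f₁ t + s * f₂ t) ^ 2 * (1 / (4 * ε)) := by fun_prop
    have c4 : Continuous fun t => ε * f₂ t ^ 2 := by fun_prop
    have e1 : (∫ t in (-(N : ℝ))..N, f₁ t * f₂ t) + s * Q N =
        ∫ t in (-(N : ℝ))..N, (f₁ t + s * f₂ t) * f₂ t := by
      rw [hQ, ← intervalIntegral.integral_const_mul, ← intervalIntegral.integral_add
        (c1.intervalIntegrable _ _) (c2.intervalIntegrable _ _)]
      exact intervalIntegral.integral_congr fun t _ => by ring
    have e2 : |∫ t in (-(N : ℝ))..N, (f₁ t + s * f₂ t) * f₂ t| ≤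
        ∫ t in (-(N : ℝ))..N, ((f₁ t + s * f₂ t) ^ 2 * (1 / (4 * ε)) + ε * f₂ t ^ 2) := by
      refine (intervalIntegral.abs_integral_le_integral_abs (hle N)).trans
        (intervalIntegral.integral_mono_on (hle N) ((i0.mul h₂).abs.intervalIntegrable _ _)
          ((c3.add c4).intervalIntegrable _ _) fun t _ => ?_)
      set g := f₁ t + s * f₂ t
      rw [abs_mul, ← sq_abs g, ← sq_abs (f₂ t)]
      have h3 : |g| ^ 2 * (1 / (4 * ε)) + ε * |f₂ t| ^ 2 - |g| * |f₂ t| =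
          (|g| - 2 * ε * |f₂ t|) ^ 2 / (4 * ε) := by field_simp; ring
      have h4 : 0 ≤ (|g| - 2 * ε * |f₂ t|) ^ 2 / (4 * ε) := by positivity
      linarith
    have e3 : (∫ t in (-(N : ℝ))..N, (f₁ t + s * f₂ t) ^ 2) ≤ G := by
      rw [intervalIntegral.integral_of_le (hle N)]
      exact setIntegral_le_integral hs (Eventually.of_forall fun t => sq_nonneg _)
    rw [e1]
    refine e2.trans ?_
    rw [intervalIntegral.integral_add (c3.intervalIntegrable _ _) (c4.intervalIntegrable _ _),
      intervalIntegral.integral_mul_const, intervalIntegral.integral_const_mul,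
      div_eq_mul_one_div G]
    gcongr
  rw [Metric.tendsto_atTop']
  intro ε hε
  have h3 : ∀ᶠ N in atTop, 1 + G / (4 * (ε / 2)) / (ε / 2) ≤ Q N :=
    hQtop.eventually_ge_atTop _
  have hGnn : 0 ≤ G := integral_nonneg fun t => sq_nonneg _
  obtain ⟨N₀, hN₀⟩ := eventually_atTop.1 h3
  refine ⟨N₀, fun N hN => ?_⟩
  have hq := hN₀ N hN.le
  have hqpos : 0 < Q N := lt_of_lt_of_le (by positivity) hq
  have hb := hbound (ε / 2) (by positivity) N
  rw [Real.dist_eq]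
  have e4 : -(∫ t in (-(N : ℝ))..N, f₁ t * f₂ t) / Q N - s =
      -((∫ t in (-(N : ℝ))..N, f₁ t * f₂ t) + s * Q N) / Q N := by field_simp; ring
  rw [e4, abs_div, abs_neg, abs_of_pos hqpos, div_lt_iff₀ hqpos]
  refine hb.trans_lt ?_
  have h5 : G / (4 * (ε / 2)) / (ε / 2) < Q N := by linarith
  rw [div_lt_iff₀ (by positivity)] at h5
  nlinarith

/-- For functions `f₁ ω`, `f₂ ω` which depend measurably on `ω`, the set of `ω` for which their
span contains a nonzero square integrable function is measurable: the coefficient of `f₂` is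
itself a measurable function of `ω` by `tendsto_neg_integral_mul_div`. -/
theorem measurableSet_exists_integrable_sq {Ω : Type*} [MeasurableSpace Ω] {f₁ f₂ : Ω → ℝ → ℝ}
    (h₁ : ∀ ω, Continuous (f₁ ω)) (h₂ : ∀ ω, Continuous (f₂ ω))
    (m₁ : ∀ t, Measurable fun ω => f₁ ω t) (m₂ : ∀ t, Measurable fun ω => f₂ ω t) :
    MeasurableSet {ω | (Integrable fun t => f₂ ω t ^ 2) ∨
      ∃ s : ℝ, Integrable fun t => (f₁ ω t + s * f₂ ω t) ^ 2} := by
  have j₁ : Measurable fun q : Ω × ℝ => f₁ q.1 q.2 :=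
    (measurable_uncurry_of_continuous_of_measurable (u := fun t ω => f₁ ω t) h₁ m₁).comp
      measurable_swap
  have j₂ : Measurable fun q : Ω × ℝ => f₂ q.1 q.2 :=
    (measurable_uncurry_of_continuous_of_measurable (u := fun t ω => f₂ ω t) h₂ m₂).comp
      measurable_swap
  have hint : ∀ {g : Ω → ℝ → ℝ}, (Measurable fun q : Ω × ℝ => g q.1 q.2) → ∀ N : ℕ,
      Measurable fun ω => ∫ t in (-(N : ℝ))..N, g ω t := fun {g} hg N => by
    simp only [intervalIntegral]
    exact (hg.stronglyMeasurable.integral_prod_right).measurable.sub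
      (hg.stronglyMeasurable.integral_prod_right).measurable
  set σ : Ω → ℝ := fun ω => limsup (fun N : ℕ => -(∫ t in (-(N : ℝ))..N, f₁ ω t * f₂ ω t) /
    ∫ t in (-(N : ℝ))..N, f₂ ω t ^ 2) atTop with hσ
  have mσ : Measurable σ := Measurable.limsup fun N => (hint (j₁.mul j₂) N).neg.div
    (hint (j₂.pow_const 2) N)
  have heq : {ω | (Integrable fun t => f₂ ω t ^ 2) ∨
      ∃ s : ℝ, Integrable fun t => (f₁ ω t + s * f₂ ω t) ^ 2} =
      {ω | Integrable fun t => f₂ ω t ^ 2} ∪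
        {ω | Integrable fun t => (f₁ ω t + σ ω * f₂ ω t) ^ 2} := by
    ext ω
    simp only [mem_ofPred_eq, mem_union]
    refine ⟨fun h => ?_, fun h => h.imp_right fun h' => ⟨_, h'⟩⟩
    by_cases h0 : Integrable fun t => f₂ ω t ^ 2
    · exact Or.inl h0
    · obtain ⟨s, hs⟩ := h.resolve_left h0
      have : σ ω = s := (tendsto_neg_integral_mul_div (h₁ ω) (h₂ ω) hs h0).limsup_eq
      exact Or.inr (this ▸ hs)
  rw [heq]
  exact (measurableSet_integrable (j₂.pow_const 2).stronglyMeasurable).union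
    (measurableSet_integrable ((j₁.add ((mσ.comp measurable_fst).mul j₂)).pow_const
      2).stronglyMeasurable)

/-! ### Explicit solutions for point interactions on the line -/

namespace PointInteraction

variable {ι : Type*} {x : ι → ℝ} (hx : ∀ p q : ℝ, {n | x n ∈ Icc p q}.Finite) (C S : ℝ → ℝ)
  (c α β : ℝ)

/-- The finite set of the interaction points which lie strictly between `c` and `t`. -/
noncomputable def between (c t : ℝ) : Finset ι :=
  (Finite.subset (hx (min c t) (max c t)) (t := {n | x n ∈ Ioo (min c t) (max c t)})
    fun _ h => Ioo_subset_Icc_self h).toFinset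

variable {hx c}

theorem mem_between {t : ℝ} {n : ι} :
    n ∈ between hx c t ↔ (c < x n ∧ x n < t) ∨ (t < x n ∧ x n < c) := by
  simp only [between, Finite.mem_toFinset, mem_ofPred_eq, mem_Ioo, min_lt_iff, lt_max_iff]
  constructor
  · rintro ⟨h1 | h1, h2 | h2⟩
    · exact absurd h1 h2.not_gt
    · exact Or.inl ⟨h1, h2⟩
    · exact Or.inr ⟨h1, h2⟩
    · exact absurd h1 h2.not_gt
  · rintro (⟨h1, h2⟩ | ⟨h1, h2⟩)
    · exact ⟨Or.inl h1, Or.inr h2⟩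
    · exact ⟨Or.inr h1, Or.inl h2⟩

theorem notMem_between_self (n : ι) : n ∉ between hx c (x n) := by
  simp [mem_between]

theorem card_between_lt {m n : ι} (h : m ∈ between hx c (x n)) :
    (between hx c (x m)).card < (between hx c (x n)).card := by
  refine Finset.card_lt_card ((Finset.ssubset_iff_of_subset fun k hk => ?_).2
    ⟨m, h, notMem_between_self m⟩)
  rw [mem_between] at h hk ⊢
  rcases h with h | h <;> rcases hk with hk | hk
  · exact Or.inl ⟨hk.1, hk.2.trans h.2⟩
  · exact absurd (hk.1.trans hk.2) h.1.not_gt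
  · exact absurd (hk.1.trans hk.2) h.2.not_gt
  · exact Or.inr ⟨h.1.trans hk.1, hk.2⟩

variable (hx c)

/-- The solution of the free equation with Cauchy data `(α, β)` at `c`, modified by a multiple
`k m` of `S (t - x m)` for all `m ∈ B`. -/
noncomputable def wave (x : ι → ℝ) (k : ι → ℝ) (B : Finset ι) (t : ℝ) : ℝ :=
  α * C (t - c) + β * S (t - c) + ∑ m ∈ B, k m * S (t - x m)

/-- The sign of `r - c`, for `r ≠ c`: the side of `c` on which `r` lies. -/
noncomputable def side (r : ℝ) : ℝ := if c < r then 1 else -1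

/-- The values at the interaction points of the solution with Cauchy data `(α, β)` at `c`,
computed by recursion along the points between `c` and the given one. -/
noncomputable def amplitude (ω : ι → ℝ) (n : ι) : ℝ :=
  α * C (x n - c) + β * S (x n - c) + ∑ m ∈ (between hx c (x n)).attach,
    ω m * side c (x m) * amplitude ω m * S (x n - x m)
termination_by (between hx c (x n)).card
decreasing_by exact card_between_lt m.2

/-- The coefficient of the wave emitted by the interaction at `x n`. It carries a sign, since the
wave travels away from `c`. -/
noncomputable def coeff (ω : ι → ℝ) (n : ι) : ℝ :=
  ω n * side c (x n) * amplitude hx C S c α β ω n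

/-- The solution with Cauchy data `(α, β)` at `c` and couplings `ω`. -/
noncomputable def solution (ω : ι → ℝ) (t : ℝ) : ℝ :=
  wave C S c α β x (coeff hx C S c α β ω) (between hx c t) t

variable {hx C S c α β}

theorem solution_x (ω : ι → ℝ) (n : ι) :
    solution hx C S c α β ω (x n) = amplitude hx C S c α β ω n := by
  rw [solution, wave, amplitude, Finset.sum_attach (between hx c (x n))
    fun m => ω m * side c (x m) * amplitude hx C S c α β ω m * S (x n - x m)]
  rfl

theorem measurable_amplitude (n : ι) : Measurable fun ω => amplitude hx C S c α β ω n := by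
  induction h : (between hx c (x n)).card using Nat.strong_induction_on generalizing n with
  | _ k ih =>
    rw [funext fun ω => amplitude.eq_1 hx C S c α β ω n]
    refine measurable_const.add (Finset.measurable_fun_sum _ fun m _ => ?_)
    exact (((measurable_pi_apply _).mul_const _).mul
      (ih _ (h ▸ card_between_lt m.2) _ rfl)).mul_const _

theorem measurable_solution (t : ℝ) : Measurable fun ω => solution hx C S c α β ω t := by
  simp only [solution, wave, coeff]
  exact measurable_const.add (Finset.measurable_fun_sum _ fun m _ =>
    (((measurable_pi_apply _).mul_const _).mul (measurable_amplitude m)).mul_const _)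

theorem solution_zero (t : ℝ) :
    solution hx C S c α β 0 t = α * C (t - c) + β * S (t - c) := by
  simp [solution, wave, coeff]

section Derivatives

variable {E : ℝ} (hCS : IsFundamentalPair E C S) (k : ι → ℝ) (B : Finset ι)
include hCS

theorem hasDerivAt_wave (t : ℝ) : HasDerivAt (wave C S c α β x k B)
    (wave (fun t => -E * S t) C c α β x k B t) t := by
  have hs : ∀ y, HasDerivAt (fun t => S (t - y)) (C (t - y)) t := fun y =>
    (hCS.hasDerivAt_S (t - y)).comp_sub_const t y
  have hc : ∀ y, HasDerivAt (fun t => C (t - y)) (-E * S (t - y)) t := fun y =>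
    (hCS.hasDerivAt_C (t - y)).comp_sub_const t y
  exact (((hc c).const_mul α).add ((hs c).const_mul β)).add
    (HasDerivAt.fun_sum fun m _ => (hs (x m)).const_mul (k m))

theorem hasDerivAt_deriv_wave (t : ℝ) :
    HasDerivAt (wave (fun t => -E * S t) C c α β x k B) (-E * wave C S c α β x k B t) t := by
  have hs : ∀ y, HasDerivAt (fun t => -E * S (t - y)) (-E * C (t - y)) t := fun y =>
    ((hCS.hasDerivAt_S (t - y)).comp_sub_const t y).const_mul _
  have hc : ∀ y, HasDerivAt (fun t => C (t - y)) (-E * S (t - y)) t := fun y =>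
    (hCS.hasDerivAt_C (t - y)).comp_sub_const t y
  refine ((((hs c).const_mul α).add ((hc c).const_mul β)).add
    (HasDerivAt.fun_sum (u := B) fun m _ => (hc (x m)).const_mul (k m))).congr_deriv ?_
  simp only [wave, mul_add, Finset.mul_sum]
  congr 1
  · ring
  · exact Finset.sum_congr rfl fun m _ => by ring

theorem contDiff_wave : ContDiff ℝ 1 (wave C S c α β x k B) := by
  refine contDiff_one_iff_deriv.2 ⟨fun t => (hasDerivAt_wave hCS k B t).differentiableAt, ?_⟩
  rw [funext fun t => (hasDerivAt_wave (x := x) (c := c) (α := α) (β := β) hCS k B t).deriv]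
  exact continuous_iff_continuousAt.2 fun t => (hasDerivAt_deriv_wave hCS k B t).continuousAt

theorem contDiff_deriv_wave : ContDiff ℝ 1 (wave (fun t => -E * S t) C c α β x k B) := by
  refine contDiff_one_iff_deriv.2
    ⟨fun t => (hasDerivAt_deriv_wave hCS k B t).differentiableAt, ?_⟩
  rw [funext fun t => (hasDerivAt_deriv_wave (x := x) (c := c) (α := α) (β := β) hCS k B t).deriv]
  exact continuous_const.mul (contDiff_wave hCS k B).continuous

end Derivatives

theorem between_congr {s t : ℝ} (h : ∀ n, x n ∉ uIcc s t) : between hx c s = between hx c t := by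
  ext n
  have hn := h n
  rw [mem_between, mem_between]
  rw [mem_uIcc] at hn
  push Not at hn
  grind

end PointInteraction

namespace DeltaData

open PointInteraction

variable {D : DeltaData} {ω : D.I → ℝ} {E c α β : ℝ} {C S : ℝ → ℝ}
  {hx : ∀ p q : ℝ, {n | D.x n ∈ Icc p q}.Finite}

/-- Off the interaction points the explicit solution is locally a fixed wave. -/
theorem solution_eventuallyEq (hJ : D.J = univ) {t : ℝ} (ht : t ∉ D.M) :
    solution hx C S c α β ω =ᶠ[𝓝 t]
      wave C S c α β D.x (coeff hx C S c α β ω) (between hx c t) := by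
  obtain ⟨p, q, hp, hq, hpq⟩ := exists_Icc_mem_nhds
    (isOpen_J_diff_M.mem_nhds (show t ∈ D.J \ D.M from ⟨hJ ▸ mem_univ t, ht⟩))
  filter_upwards [Ioo_mem_nhds hp hq] with s hs
  rw [solution, between_congr (s := s) (t := t) fun n hn => ?_]
  exact (hpq (uIcc_subset_Icc (Ioo_subset_Icc_self hs) ⟨hp.le, hq.le⟩ hn)).2 ⟨n, rfl⟩

theorem hasDerivAt_solution (hJ : D.J = univ) (hCS : IsFundamentalPair E C S) {t : ℝ}
    (ht : t ∉ D.M) : HasDerivAt (fun s => (solution hx C S c α β ω s : ℂ))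
      (wave (fun t => -E * S t) C c α β D.x (coeff hx C S c α β ω) (between hx c t) t : ℝ) t :=
  ((hasDerivAt_wave hCS _ _ t).congr_of_eventuallyEq
    (solution_eventuallyEq hJ ht)).ofReal_comp

theorem isAdmissible_solution (hJ : D.J = univ) (hCS : IsFundamentalPair E C S) (hc : c ∉ D.M) :
    D.IsAdmissible ω fun t => (solution hx C S c α β ω t : ℂ) := by
  have hacC : ∀ {f : ℝ → ℝ} {g : ℝ → ℂ} {p q : ℝ}, ContDiff ℝ 1 f → p ≤ q →
      (∀ t ∈ Icc p q, g t = f t) → AbsolutelyContinuousOnInterval g p q := by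
    intro f g p q hf hpq h
    refine IsAdmissible.congr_ac (f := fun t => (f t : ℂ))
      (hf.contDiffOn.absolutelyContinuousOnInterval.of_dist_le fun s t => ?_)
      fun t ht => (h t (by rwa [uIcc_of_le hpq] at ht)).symm
    rw [Complex.dist_eq, ← Complex.ofReal_sub, Complex.norm_real, Real.dist_eq, Real.norm_eq_abs]
  have hconst : ∀ {p q : ℝ}, Icc p q ⊆ D.J \ D.M → ∀ t ∈ Icc p q,
      between hx c t = between hx c p := fun {p q} h t ht => between_congr fun n hn =>
    (h (uIcc_subset_Icc ht ⟨le_rfl, ht.1.trans ht.2⟩ hn)).2 ⟨n, rfl⟩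
  -- Near `x n` the solution is a fixed wave on each side of `x n`.
  have hside : ∀ n, ∃ Bl Br : Finset D.I,
      (∀ᶠ t in 𝓝[<] D.x n, between hx c t = Bl) ∧ (∀ᶠ t in 𝓝[>] D.x n, between hx c t = Br) ∧
      (∀ k : D.I → ℝ, wave C S c α β D.x k Bl (D.x n) =
        wave C S c α β D.x k (between hx c (D.x n)) (D.x n)) ∧
      (∀ k : D.I → ℝ, wave C S c α β D.x k Br (D.x n) =
        wave C S c α β D.x k (between hx c (D.x n)) (D.x n)) ∧
      ∀ k : D.I → ℝ, wave (fun t => -E * S t) C c α β D.x k Br (D.x n) -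
        wave (fun t => -E * S t) C c α β D.x k Bl (D.x n) = k n * side c (D.x n) := by
    classical
    intro n
    have hcn : c ≠ D.x n := fun h => hc ⟨n, h.symm⟩
    obtain ⟨p, q, hp, hq, -, hpq⟩ := exists_Icc_diff_M isOpen_J subset_rfl (x_mem_J n)
    have hother : ∀ m, m ≠ n → D.x m < p ∨ q < D.x m := fun m hm => by
      by_contra! h
      exact (hpq _ h fun h' => hm (D.x_inj h')).2 ⟨m, rfl⟩
    have hnot := notMem_between_self (hx := hx) (c := c) n
    rcases hcn.lt_or_gt with h | h
    · refine ⟨between hx c (D.x n), insert n (between hx c (D.x n)), ?_, ?_, fun k => rfl,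
        fun k => ?_, fun k => ?_⟩
      · filter_upwards [Ioo_mem_nhdsLT hp, Ioo_mem_nhdsLT h] with t ht ht'
        ext m
        by_cases hm : m = n
        · subst hm
          simp only [mem_between]
          grind
        · have := hother m hm
          simp only [mem_between]
          grind
      · filter_upwards [Ioo_mem_nhdsGT hq] with t ht
        ext m
        by_cases hm : m = n
        · subst hm
          simp only [mem_between, Finset.mem_insert]
          grind
        · have := hother m hm
          simp only [mem_between, Finset.mem_insert, hm, false_or]
          grind
      · simp [wave, Finset.sum_insert hnot, hCS.S_zero]
      · simp [wave, Finset.sum_insert hnot, hCS.C_zero, side, h]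
    · refine ⟨insert n (between hx c (D.x n)), between hx c (D.x n), ?_, ?_, fun k => ?_,
        fun k => rfl, fun k => ?_⟩
      · filter_upwards [Ioo_mem_nhdsLT hp] with t ht
        ext m
        by_cases hm : m = n
        · subst hm
          simp only [mem_between, Finset.mem_insert]
          grind
        · have := hother m hm
          simp only [mem_between, Finset.mem_insert, hm, false_or]
          grind
      · filter_upwards [Ioo_mem_nhdsGT hq, Ioo_mem_nhdsGT h] with t ht ht'
        ext m
        by_cases hm : m = n
        · subst hm
          simp only [mem_between]
          grind
        · have := hother m hm
          simp only [mem_between]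
          grind
      · simp [wave, Finset.sum_insert hnot, hCS.S_zero]
      · simp [wave, Finset.sum_insert hnot, hCS.C_zero, side, h.not_gt]
  have hwave : ∀ k B, Continuous (wave C S c α β D.x k B) := fun k B =>
    (contDiff_wave hCS k B).continuous
  have hwave' : ∀ k B, Continuous (wave (fun t => -E * S t) C c α β D.x k B) := fun k B =>
    (contDiff_deriv_wave hCS k B).continuous
  refine ⟨fun t ht => (hasDerivAt_solution hJ hCS ht.2).differentiableAt, fun p q hpq h => ?_,
    fun p q hpq h => ?_, fun n => ?_, fun n => ?_⟩
  · refine hacC (f := wave C S c α β D.x _ _)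
      (contDiff_wave hCS (coeff hx C S c α β ω) (between hx c p)) hpq fun t ht => ?_
    rw [solution, hconst h t ht]
  · refine hacC (f := wave (fun t => -E * S t) C c α β D.x _ _)
      (contDiff_deriv_wave hCS (coeff hx C S c α β ω) (between hx c p)) hpq
      fun t ht => ?_
    rw [(hasDerivAt_solution hJ hCS (h ht).2).deriv, hconst h t ht]
  · obtain ⟨Bl, Br, hl, hr, el, er, -⟩ := hside n
    refine Complex.continuous_ofReal.continuousAt.comp ?_
    rw [continuousAt_iff_continuous_left'_right']
    constructor
    · have h := (hwave (coeff hx C S c α β ω) Bl).continuousAt.continuousWithinAt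
        (s := Iio (D.x n)) (x := D.x n)
      refine h.congr_of_eventuallyEq (hl.mono fun t ht => ?_) (el _).symm
      rw [solution, ht]
    · have h := (hwave (coeff hx C S c α β ω) Br).continuousAt.continuousWithinAt
        (s := Ioi (D.x n)) (x := D.x n)
      refine h.congr_of_eventuallyEq (hr.mono fun t ht => ?_) (er _).symm
      rw [solution, ht]
  · obtain ⟨Bl, Br, hl, hr, -, -, e⟩ := hside n
    have hM := eventually_notMem_M (x_mem_J n)
    refine ⟨_, _, (((Complex.continuous_ofReal.comp (hwave' (coeff hx C S c α β ω) Bl)).tendsto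
      (D.x n)).mono_left nhdsWithin_le_nhds).congr' ?_,
      (((Complex.continuous_ofReal.comp (hwave' (coeff hx C S c α β ω) Br)).tendsto
      (D.x n)).mono_left nhdsWithin_le_nhds).congr' ?_, ?_⟩
    · filter_upwards [hl, hM.filter_mono (nhdsLT_le_nhdsNE _)] with t h1 h2
      rw [(hasDerivAt_solution hJ hCS h2.2).deriv, h1]
      rfl
    · filter_upwards [hr, hM.filter_mono (nhdsGT_le_nhdsNE _)] with t h1 h2
      rw [(hasDerivAt_solution hJ hCS h2.2).deriv, h1]
      rfl
    · simp only [Function.comp]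
      rw [← Complex.ofReal_sub, e, solution_x, ← Complex.ofReal_mul, coeff]
      have hs : side c (D.x n) * side c (D.x n) = 1 := by
        unfold side; split_ifs <;> norm_num
      congr 1
      linear_combination (ω n * amplitude hx C S c α β ω n) * hs

theorem isSolution_solution (hJ : D.J = univ) (hV : ∀ t, D.V t = 0)
    (hCS : IsFundamentalPair E C S) (hc : c ∉ D.M) :
    D.IsSolution ω E fun t => (solution hx C S c α β ω t : ℂ) := by
  refine ⟨isAdmissible_solution hJ hCS hc, ?_⟩
  filter_upwards [ae_mem_J_diff_M] with t ht
  set k := coeff hx C S c α β ω with hk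
  have h1 : deriv (fun t => (solution hx C S c α β ω t : ℂ)) =ᶠ[𝓝 t]
      fun s => ((wave (fun t => -E * S t) C c α β D.x k (between hx c t) s : ℝ) : ℂ) := by
    filter_upwards [(solution_eventuallyEq (c := c) (α := α) (β := β) (C := C) (S := S) (hx := hx)
      (ω := ω) hJ ht.2).eventuallyEq_nhds] with s hs
    exact ((hasDerivAt_wave hCS k _ s).congr_of_eventuallyEq hs).ofReal_comp.deriv
  rw [tau, h1.deriv_eq, (hasDerivAt_deriv_wave hCS k _ t).ofReal_comp.deriv, hV, solution]
  push_cast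
  ring

theorem solution_base (hCS : IsFundamentalPair E C S) : solution hx C S c α β ω c = α := by
  have h : between hx c c = ∅ := by
    ext n
    simp only [mem_between, Finset.notMem_empty, iff_false]
    grind
  simp [solution, wave, h, hCS.C_zero, hCS.S_zero]

theorem deriv_solution_base (hJ : D.J = univ) (hCS : IsFundamentalPair E C S) (hc : c ∉ D.M) :
    deriv (fun t => (solution hx C S c α β ω t : ℂ)) c = β := by
  have h : between hx c c = ∅ := by
    ext n
    simp only [mem_between, Finset.notMem_empty, iff_false]
    grind
  rw [(hasDerivAt_solution hJ hCS hc).deriv]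
  simp [wave, h, hCS.C_zero, hCS.S_zero]

theorem IsSolution.add {z : ℂ} {u v : ℝ → ℂ} (hu : D.IsSolution ω z u) (hv : D.IsSolution ω z v) :
    D.IsSolution ω z (u + v) := by
  refine ⟨hu.1.add hv.1, ?_⟩
  filter_upwards [hu.2, hv.2, hu.1.tau_add hv.1] with t h1 h2 h3
  rw [h3, Pi.add_apply]
  linear_combination h1 + h2

theorem IsSolution.smul {z : ℂ} {u : ℝ → ℂ} (k : ℂ) (hu : D.IsSolution ω z u) :
    D.IsSolution ω z (k • u) := by
  refine ⟨hu.1.smul k, ?_⟩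
  filter_upwards [hu.2] with t h1
  rw [IsAdmissible.tau_smul, Pi.smul_apply, smul_eq_mul]
  linear_combination k * h1

/-- Every solution is a combination of the two explicit ones. -/
theorem IsSolution.eq_combination (hJ : D.J = univ) (hV : ∀ t, D.V t = 0)
    (hCS : IsFundamentalPair E C S) (hc : c ∉ D.M) {u : ℝ → ℂ} (hu : D.IsSolution ω E u) (t : ℝ) :
    u t = u c * solution hx C S c 1 0 ω t + deriv u c * solution hx C S c 0 1 ω t := by
  have hcJ : c ∈ D.J \ D.M := ⟨hJ ▸ mem_univ c, hc⟩
  have s1 : D.IsSolution ω E fun t => (solution hx C S c 1 0 ω t : ℂ) :=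
    isSolution_solution hJ hV hCS hc
  have s2 : D.IsSolution ω E fun t => (solution hx C S c 0 1 ω t : ℂ) :=
    isSolution_solution hJ hV hCS hc
  have s3 := s1.smul (-u c)
  have s4 := s2.smul (-deriv u c)
  have s5 := hu.add (s3.add s4)
  have hd := (s5.1.continuousAt_deriv hcJ).tendsto
  rw [hu.1.deriv_add (s3.1.add s4.1) hcJ, s3.1.deriv_add s4.1 hcJ, IsAdmissible.deriv_smul,
    IsAdmissible.deriv_smul, Pi.smul_apply, Pi.smul_apply, deriv_solution_base hJ hCS hc,
    deriv_solution_base hJ hCS hc] at hd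
  simp only [Complex.ofReal_zero, Complex.ofReal_one, smul_eq_mul, mul_zero, mul_one,
    zero_add, add_neg_cancel] at hd
  have h0 := s5.eq_zero hcJ.1 (by
    simp only [Pi.add_apply, Pi.smul_apply, solution_base hCS]
    simp) (Or.inl (hd.mono_left nhdsWithin_le_nhds)) (hJ ▸ mem_univ t)
  simp only [Pi.add_apply, Pi.smul_apply, smul_eq_mul] at h0
  linear_combination h0

/-! ### The free Laplacian with point interactions on the line -/

theorem memLp_ofReal_iff {f : ℝ → ℝ} (hf : Continuous f) :
    MemLp (fun t => (f t : ℂ)) 2 volume ↔ Integrable fun t => f t ^ 2 := by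
  rw [← memLp_two_iff_integrable_sq hf.aestronglyMeasurable]
  exact ⟨fun h => h.re, fun h => h.ofReal⟩

/-- On the line without boundary conditions, the eigenfunctions are the nonzero square integrable
solutions. -/
theorem IsSolution.isEigenfunction (ha : D.a = ⊥) (hb : D.b = ⊤) {u : ℝ → ℂ}
    (hu : D.IsSolution ω E u) (h2 : MemLp u 2 volume) {t : ℝ} (h0 : u t ≠ 0) :
    D.IsEigenfunction ω E u := by
  have hJ : D.J = univ := by ext t; simp [J, ha, hb]
  refine ⟨hu, by rwa [hJ, Measure.restrict_univ], ?_, ?_, t, hJ ▸ mem_univ t, h0⟩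
  · rintro ⟨a₀, h, -⟩
    rw [ha] at h
    exact absurd h.symm (EReal.coe_ne_bot a₀)
  · rintro ⟨b₀, h, -⟩
    rw [hb] at h
    exact absurd h.symm (EReal.coe_ne_top b₀)

theorem measure_A_eq_zero_of_free (hD : D.LimitPointOrRegular) (p : D.I → Measure ℝ)
    [∀ n, IsProbabilityMeasure (p n)] (hcont : ∀ n r, p n {r} = 0) (ha : D.a = ⊥) (hb : D.b = ⊤)
    (hV : ∀ t, D.V t = 0) (E : ℝ) : D.P p (D.A E) = 0 := by
  have hJ : D.J = univ := by ext t; simp [J, ha, hb]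
  have hx : ∀ p q : ℝ, {n | D.x n ∈ Icc p q}.Finite := fun p q =>
    D.x_locFin p q (by simp [ha]) (by simp [hb])
  obtain ⟨c, hc⟩ : ∃ c, c ∉ D.M := by
    by_contra! h
    exact Set.not_countable_univ ((countable_range D.x).mono fun t _ => h t)
  obtain ⟨C, S, hCS⟩ := exists_isFundamentalPair E
  have hcont' : ∀ (α β : ℝ) (ω : D.I → ℝ), Continuous (solution hx C S c α β ω) := fun α β ω => by
    have h : Continuous fun t => (solution hx C S c α β ω t : ℂ) :=
      continuous_iff_continuousAt.2 fun t =>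
        (isAdmissible_solution hJ hCS hc).continuousAt_of_mem_J (hJ ▸ mem_univ t)
    exact Complex.continuous_re.comp h
  have hA : MeasurableSet (D.A E) := by
    have heq : D.A E = {ω | (Integrable fun t => solution hx C S c 0 1 ω t ^ 2) ∨
        ∃ s : ℝ, Integrable fun t =>
          (solution hx C S c 1 0 ω t + s * solution hx C S c 0 1 ω t) ^ 2} := by
      ext ω
      rw [mem_A_iff, mem_ofPred_eq]
      have s1 : D.IsSolution ω E fun t => (solution hx C S c 1 0 ω t : ℂ) :=
        isSolution_solution hJ hV hCS hc
      have s2 : D.IsSolution ω E fun t => (solution hx C S c 0 1 ω t : ℂ) :=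
        isSolution_solution hJ hV hCS hc
      constructor
      · rintro ⟨u, hu⟩
        have hL := hu.memLp
        rw [hJ, Measure.restrict_univ] at hL
        have hcomb := hu.sol.eq_combination (hx := hx) hJ hV hCS hc
        by_cases h0 : u c = 0
        · have h1 : deriv u c ≠ 0 := fun h1 => by
            obtain ⟨t, -, ht⟩ := hu.exists_ne
            exact ht (by rw [hcomb t, h0, h1]; ring)
          refine Or.inl ((memLp_ofReal_iff (hcont' 0 1 ω)).1 ?_)
          convert hL.const_smul (deriv u c)⁻¹ using 1
          ext t
          rw [Pi.smul_apply, hcomb t, h0, smul_eq_mul]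
          field_simp
          ring
        · refine Or.inr ⟨(deriv u c / u c).re, ?_⟩
          have hcon : Continuous fun t => solution hx C S c 1 0 ω t +
              (deriv u c / u c).re * solution hx C S c 0 1 ω t :=
            (hcont' 1 0 ω).add (continuous_const.mul (hcont' 0 1 ω))
          rw [← memLp_two_iff_integrable_sq hcon.aestronglyMeasurable]
          refine MemLp.ae_eq (Eventually.of_forall fun t => ?_) (hL.const_smul (u c)⁻¹).re
          have h1 : (u c)⁻¹ * u t = solution hx C S c 1 0 ω t +
              (deriv u c / u c) * solution hx C S c 0 1 ω t := by
            rw [hcomb t]; field_simp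
          rw [Pi.smul_apply, smul_eq_mul, h1]
          simp
      · rintro (h | ⟨s, hs⟩)
        · obtain ⟨t, ht⟩ : ∃ t, (solution hx C S c 0 1 ω t : ℂ) ≠ 0 := by
            by_contra! h0
            have h1 := deriv_solution_base (ω := ω) (α := 0) (β := 1) (hx := hx) hJ hCS hc
            rw [funext h0, deriv_const] at h1
            simp at h1
          exact ⟨_, s2.isEigenfunction ha hb ((memLp_ofReal_iff (hcont' 0 1 ω)).2 h) ht⟩
        · have h1 := (memLp_ofReal_iff ((hcont' 1 0 ω).add
            (continuous_const.mul (hcont' 0 1 ω)))).2 hs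
          refine ⟨_, (s1.add (s2.smul (s : ℂ))).isEigenfunction ha hb (t := c) ?_ ?_⟩
          · convert h1 using 1
            ext t
            simp
          · simp only [Pi.add_apply, Pi.smul_apply, solution_base hCS]
            simp
    rw [heq]
    exact measurableSet_exists_integrable_sq (hcont' 1 0) (hcont' 0 1) measurable_solution
      measurable_solution
  rw [Measure.completion_apply]
  by_contra h0
  obtain ⟨ω, u, hu, hz⟩ :=
    exists_eigenfunction_eq_zero_of_measure_ne_zero hD p hcont hA.nullMeasurableSet h0
  -- The eigenfunction does not feel the interactions, so it solves the free equation.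
  have hu0 : D.IsEigenfunction 0 E u := hu.congr_coupling fun n => Or.inr (hz n)
  have hcomb : ∀ t, u t = u c * C (t - c) + deriv u c * S (t - c) := fun t => by
    rw [hu0.sol.eq_combination (hx := hx) hJ hV hCS hc t, solution_zero, solution_zero]
    push_cast
    ring
  have hL := hu0.memLp
  rw [hJ, Measure.restrict_univ] at hL
  have hi := (memLp_two_iff_integrable_sq_norm hL.1).1 hL
  obtain ⟨t, -, ht⟩ := hu.exists_ne
  refine ht ?_
  rw [hcomb t]
  refine hCS.eq_zero_of_integrable (u c) (deriv u c) c ?_ t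
  simpa only [← hcomb] using hi

end DeltaData

theorem mainTheorem11 (D : DeltaData) (hD : D.LimitPointOrRegular)
    (p : D.I → Measure ℝ) (hprob : ∀ n, IsProbabilityMeasure (p n))
    (hcont : ∀ (n : D.I) (r : ℝ), p n {r} = 0) (E : ℝ) :
    (MeasurableFamily (Ω := D.Omega p) (fun ω => D.operator ω) →
      D.P p (D.A E) = 0 ∨ D.A E = Set.univ) ∧
    (D.a = ⊥ → D.b = ⊤ → (∀ t, D.V t = 0) →
      (∀ m n, p m = p n) → (∃ C : ℝ, ∀ n, p n (Set.Icc (-C) C)ᶜ = 0) →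
      D.P p (D.A E) = 0) :=
  ⟨fun h => DeltaData.measure_A_eq_zero_or_eq_univ hD p hcont h,
    fun ha hb hV _ _ => DeltaData.measure_A_eq_zero_of_free hD p hcont ha hb hV E⟩
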